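/- Let $(S,\Sigma,\lambda)$ and $(Y,\mu)$ be $\sigma$-finite measure spaces and let $B:Y\to\Sigma$ be a core map, that is: (I) the range of $B$ is totally ordered by inclusion; (II) for every $E\in\Sigma$ the function $y\mapsto\lambda(E\cap B(y))$ is $\mu$-measurable; (III) $\bigcup_{y\in Y}B(y)=\bigcup_{y\in Y_0}B(y)$ for some countable $Y_0\subseteq Y$; (IV) $\lambda(B(y))<\infty$ for all $y\in Y$. For $\lambda$-measurable $g:S\to[0,\infty]$ let $K_Bg(y)=\int_{B(y)}g\,d\lambda$. For a non-increasing $b:(0,\infty)\to[0,\infty]$ (such functions are called normal form parameters) and Lebesgue measurable $f:(0,\infty)\to[0,\infty]$ let $H_bf(x)=\int_0^{b(x)}f(t)\,dt$. For $p,q\in(0,\infty]$, the operator $K_B:L^p_\lambda\to L^q_\mu$ is bounded if there is a finite $C\ge0$ such that $\|K_Bg\|_{L^q_\mu}\le C\|g\|_{L^p_\lambda}$ for all measurable $g:S\to[0,\infty]$; its operator norm is the smallest $C\in[0,\infty]$ for which this inequality holds, so it is $\infty$ if $K_B$ is unbounded. Boundedness of $H_b:L^p\to L^q$ and its operator norm,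 denoted $N_{p,q}(b)$, are defined in the same way, with $L^p=L^p(0,\infty)$ taken with respect to Lebesgue measure. For $p,q\in[1,\infty]$, either operator is compact if it is bounded and its linear extension to the $L^p$-space of complex-valued functions, given by the same integral formula, is a compact operator into the corresponding $L^q$-space. Let $b=(\lambda\circ B)^*$ be the non-increasing rearrangement of $y\mapsto\lambda(B(y))$ with respect to $\mu$, that is, $$b(x)=\sup\{t>0:\ \mu\{y\in Y:\lambda(B(y))>t\}>x\},\quad x>0,\qquad \sup\emptyset=0.$$ Then $b$ is a normal form parameter. If $1\le p\le\infty$ and $0<q\le\infty$, then $K_B:L^p_\lambda\to L^q_\mu$ is bounded if and only if $H_b:L^p\to L^q$ is bounded, and the operator norm of $K_B$ is $N_{p,q}(b)$. If $1<p\le q<\infty$, then $K_B:L^p_\lambda\to L^q_\mu$ is compact if and only if $H_b:L^p\to L^q$ is compact. -/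

import Mathlib

open MeasureTheory Set
open scoped ENNReal

noncomputable section

namespace HardyNF

/-- Core maps `B : Y → Σ`, where `Σ` is the σ-algebra of `S`. Being `μ`-measurable means measurable
up to a `μ`-null set (in particular, every measurable function qualifies). -/
structure IsCoreMap {S Y : Type*} [MeasurableSpace S] [MeasurableSpace Y]
    (lam : Measure S) (mu : Measure Y) (B : Y → Set S) : Prop where
  measurableSet : ∀ y, MeasurableSet (B y)
  totallyOrdered : IsChain (· ⊆ ·) (range B)
  measurability : ∀ E : Set S, MeasurableSet E → AEMeasurable (fun y => lam (E ∩ B y)) mu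
  sigmaBounded : ∃ Y₀ : Set Y, Y₀.Countable ∧ ⋃ y, B y = ⋃ y ∈ Y₀, B y
  finiteness : ∀ y, lam (B y) < ∞

/-- Lebesgue measure on `(0,∞)`. Functions on `(0,∞)` are represented by functions on `ℝ`
whose values outside `(0,∞)` play no role. -/
def halfLine : Measure ℝ := volume.restrict (Ioi 0)

/-- The normal form parameters: non-increasing functions `(0,∞) → [0,∞]`. -/
def IsNormalFormParameter (b : ℝ → ℝ≥0∞) : Prop := AntitoneOn b (Ioi 0)

/-- The generalized inverse `b⁻¹(y) = sup {x > 0 : y < b x}`, where `sup ∅ = 0`. -/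
def generalizedInverse (b : ℝ → ℝ≥0∞) (y : ℝ) : ℝ≥0∞ :=
  ⨆ (x : ℝ) (_ : 0 < x) (_ : ENNReal.ofReal y < b x), ENNReal.ofReal x

/-- The distribution function `μ_f(t) = μ {y : f y > t}` of a non-negative function. -/
def distributionFunction {Y : Type*} [MeasurableSpace Y] (mu : Measure Y) (f : Y → ℝ≥0∞)
    (t : ℝ) : ℝ≥0∞ :=
  mu {y | ENNReal.ofReal t < f y}

/-- The non-increasing rearrangement `f*` of a non-negative function, with respect to `μ`. -/
def rearrangement {Y : Type*} [MeasurableSpace Y] (mu : Measure Y) (f : Y → ℝ≥0∞) :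
    ℝ → ℝ≥0∞ :=
  generalizedInverse (distributionFunction mu f)

/-- The abstract Hardy operator `K_B g(y) = ∫_{B(y)} g dλ` on non-negative functions. -/
def abstractHardy {S Y : Type*} [MeasurableSpace S] (lam : Measure S) (B : Y → Set S)
    (g : S → ℝ≥0∞) (y : Y) : ℝ≥0∞ :=
  ∫⁻ s in B y, g s ∂lam

/-- The same formula on complex-valued functions. -/
def abstractHardyComplex {S Y : Type*} [MeasurableSpace S] (lam : Measure S) (B : Y → Set S)
    (g : S → ℂ) (y : Y) : ℂ :=
  ∫ s in B y, g s ∂lam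

/-- The interval `(0,c)` for `c ∈ [0,∞]`. -/
def initialInterval (c : ℝ≥0∞) : Set ℝ := {t | 0 < t ∧ ENNReal.ofReal t < c}

/-- The normal form Hardy operator `H_b f(x) = ∫_0^{b(x)} f(t) dt` on non-negative functions. -/
def normalHardy (b : ℝ → ℝ≥0∞) (f : ℝ → ℝ≥0∞) (x : ℝ) : ℝ≥0∞ :=
  ∫⁻ t in initialInterval (b x), f t

/-- The same formula on complex-valued functions. -/
def normalHardyComplex (b : ℝ → ℝ≥0∞) (f : ℝ → ℂ) (x : ℝ) : ℂ :=
  ∫ t in initialInterval (b x), f t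

section Operators

variable {S Y : Type*} [MeasurableSpace S] [MeasurableSpace Y]

/-- `‖T g‖_{L^q_μ} ≤ C ‖g‖_{L^p_λ}` for all measurable `g : S → [0,∞]`. -/
def HardyInequality (lam : Measure S) (mu : Measure Y) (T : (S → ℝ≥0∞) → Y → ℝ≥0∞)
    (p q C : ℝ≥0∞) : Prop :=
  ∀ g : S → ℝ≥0∞, Measurable g → eLpNorm (T g) q mu ≤ C * eLpNorm g p lam

/-- `T : L^p_λ → L^q_μ` is bounded: the inequality holds with some finite constant. -/
def IsBoundedOp (lam : Measure S) (mu : Measure Y) (T : (S → ℝ≥0∞) → Y → ℝ≥0∞)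
    (p q : ℝ≥0∞) : Prop :=
  ∃ C : ℝ≥0∞, C ≠ ∞ ∧ HardyInequality lam mu T p q C

/-- The operator norm in `[0,∞]` of `T : L^p_λ → L^q_μ`: the best constant. -/
def opNorm (lam : Measure S) (mu : Measure Y) (T : (S → ℝ≥0∞) → Y → ℝ≥0∞)
    (p q : ℝ≥0∞) : ℝ≥0∞ :=
  sInf {C | HardyInequality lam mu T p q C}

/-- `T : L^p_λ → L^q_μ` is compact: `T` is bounded, and its extension to a linear operator between
the spaces of complex-valued functions, given by the formula `Tc`, is a compact operator. -/
def IsCompactOp (lam : Measure S) (mu : Measure Y) (T : (S → ℝ≥0∞) → Y → ℝ≥0∞)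
    (Tc : (S → ℂ) → Y → ℂ) (p q : ℝ≥0∞) [Fact (1 ≤ p)] [Fact (1 ≤ q)] : Prop :=
  IsBoundedOp lam mu T p q ∧
    ∃ L : Lp ℂ p lam →L[ℂ] Lp ℂ q mu,
      (∀ f : Lp ℂ p lam, (L f : Y → ℂ) =ᵐ[mu] Tc f) ∧ IsCompactOperator L

end Operators

/-- `N_{p,q}(b)`: the smallest constant in the normal form Hardy inequality with parameter `b`. -/
def normalFormNorm (p q : ℝ≥0∞) (b : ℝ → ℝ≥0∞) : ℝ≥0∞ :=
  opNorm halfLine halfLine (normalHardy b) p q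

end HardyNF

end

open HardyNF

/-! Both operators are compared with an intermediate one, f ↦ ∫_0^{λ(B(y))} f from functions on
(0,∞) to functions on Y, and the three turn out to satisfy Hardy inequalities with exactly the same
constants. In one direction, Hardy–Littlewood gives K_B g(y) ≤ ∫_0^{λ(B(y))} g*, and g* has the same
L^p norm as g (`hardyInequality_abstractHardy_of_primitive`). In the other, given f and finitely
many core sets, average f over the intervals between consecutive values of λ(B) and put these
averages on the corresponding gaps of the chain. The resulting g reproduces ∫_0^{λ(B(z))} f at the
chosen points, and Jensen gives ‖g‖_p ≤ ‖f‖_p because p ≥ 1 (`exists_average`). A countable monotone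
exhaustion then reaches all y (`hardyInequality_primitive_of_abstractHardy`). Finally λ∘B and b are
equimeasurable, and composing with the monotone, left continuous function c ↦ ∫_0^c f keeps them so;
hence the L^q norms agree.

Compactness is transferred through a criterion stated purely with inequalities: a bounded Hardy
operator is compact iff, for every ε, it has constant at most ε on some tail where λ(B) is positive
and near 0 or large. Compactness forces small tails since q < ∞. Conversely, off the tails the
output is Hölder continuous in λ(B(y)) with exponent 1 - 1/p > 0 on a set of finite measure, so
finitely many functionals control it. Boundedness makes the sets {λ(B) > s}, s > 0, have finite
measure; the distribution on the tails is then determined by that of λ∘B, and the criterion passes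
to b. -/

namespace HardyNF

open Filter Topology

/-! ### Initial intervals and the layer cake formula -/

theorem measurableSet_initialInterval (c : ℝ≥0∞) : MeasurableSet (initialInterval c) :=
  measurableSet_Ioi.inter (measurableSet_lt ENNReal.measurable_ofReal measurable_const)

theorem initialInterval_top : initialInterval ∞ = Ioi 0 := by
  ext t; simp [initialInterval]

theorem initialInterval_of_ne_top {c : ℝ≥0∞} (hc : c ≠ ∞) :
    initialInterval c = Ioo 0 c.toReal := by
  ext t
  simp only [initialInterval, mem_ofPred_eq, mem_Ioo]
  exact and_congr_right fun ht => ENNReal.ofReal_lt_iff_lt_toReal ht.le hc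

theorem volume_initialInterval (c : ℝ≥0∞) : volume (initialInterval c) = c := by
  rcases eq_or_ne c ∞ with rfl | hc
  · rw [initialInterval_top, Real.volume_Ioi]
  · rw [initialInterval_of_ne_top hc, Real.volume_Ioo, sub_zero, ENNReal.ofReal_toReal hc]

theorem initialInterval_mono {a c : ℝ≥0∞} (h : a ≤ c) : initialInterval a ⊆ initialInterval c :=
  fun _ ht => ⟨ht.1, ht.2.trans_le h⟩

theorem initialInterval_inter (a c : ℝ≥0∞) :
    initialInterval a ∩ initialInterval c = initialInterval (min a c) := by
  ext t; simp only [initialInterval, mem_inter_iff, mem_ofPred_eq, lt_min_iff]; tauto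

theorem initialInterval_subset_Ioi (c : ℝ≥0∞) : initialInterval c ⊆ Ioi 0 := fun _ ht => ht.1

instance : SigmaFinite halfLine := by unfold halfLine; infer_instance

/-- Layer cake formula for functions with values in `[0,∞]`. -/
theorem lintegral_eq_lintegral_halfLine_meas_lt {X : Type*} [MeasurableSpace X] (m : Measure X)
    [SFinite m] {u : X → ℝ≥0∞} (hu : AEMeasurable u m) :
    ∫⁻ x, u x ∂m = ∫⁻ t, m {x | ENNReal.ofReal t < u x} ∂halfLine := by
  have key : ∀ v : X → ℝ≥0∞, Measurable v →
      ∫⁻ x, v x ∂m = ∫⁻ t, m {x | ENNReal.ofReal t < v x} ∂halfLine := by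
    intro v hv
    have hmeas : MeasurableSet {z : X × ℝ | ENNReal.ofReal z.2 < v z.1} :=
      measurableSet_lt (by fun_prop) (by fun_prop)
    have h1 : ∀ x, v x = ∫⁻ t, {z : X × ℝ | ENNReal.ofReal z.2 < v z.1}.indicator 1 (x, t)
        ∂halfLine := by
      intro x
      have : (fun t => {z : X × ℝ | ENNReal.ofReal z.2 < v z.1}.indicator (1 : X × ℝ → ℝ≥0∞) (x, t))
          = {t : ℝ | ENNReal.ofReal t < v x}.indicator 1 := by
        ext t; simp [indicator]
      have hs : MeasurableSet {t : ℝ | ENNReal.ofReal t < v x} :=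
        measurableSet_lt ENNReal.measurable_ofReal measurable_const
      rw [this, lintegral_indicator_one hs, halfLine, Measure.restrict_apply hs]
      conv_lhs => rw [← volume_initialInterval (v x)]
      congr 1; ext t; simp [initialInterval, and_comm]
    rw [lintegral_congr h1, lintegral_lintegral_swap]
    · refine lintegral_congr fun t => ?_
      have hs : MeasurableSet {x | ENNReal.ofReal t < v x} := measurableSet_lt measurable_const hv
      rw [← lintegral_indicator_one hs]
      rfl
    · exact (measurable_one.indicator hmeas).aemeasurable
  rw [lintegral_congr_ae hu.ae_eq_mk, key _ hu.measurable_mk]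
  refine lintegral_congr fun t => measure_congr ?_
  filter_upwards [hu.ae_eq_mk] with x hx
  exact congrArg (ENNReal.ofReal t < ·) hx.symm

/-! ### Equimeasurable functions -/

section Equimeasurable

variable {X₁ X₂ : Type*} [MeasurableSpace X₁] [MeasurableSpace X₂] {m₁ : Measure X₁}
  {m₂ : Measure X₂} {u₁ : X₁ → ℝ≥0∞} {u₂ : X₂ → ℝ≥0∞}

/-- Equimeasurable functions with values in `[0,∞]`. -/
def Equimeasurable (m₁ : Measure X₁) (m₂ : Measure X₂) (u₁ : X₁ → ℝ≥0∞) (u₂ : X₂ → ℝ≥0∞) : Prop :=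
  ∀ s : ℝ≥0∞, m₁ {x | s < u₁ x} = m₂ {x | s < u₂ x}

theorem Equimeasurable.lintegral_eq [SFinite m₁] [SFinite m₂] (h : Equimeasurable m₁ m₂ u₁ u₂)
    (h₁ : AEMeasurable u₁ m₁) (h₂ : AEMeasurable u₂ m₂) :
    ∫⁻ x, u₁ x ∂m₁ = ∫⁻ x, u₂ x ∂m₂ := by
  rw [lintegral_eq_lintegral_halfLine_meas_lt m₁ h₁, lintegral_eq_lintegral_halfLine_meas_lt m₂ h₂]
  exact lintegral_congr fun t => h _

theorem Equimeasurable.rpow (h : Equimeasurable m₁ m₂ u₁ u₂) {r : ℝ} (hr : 0 < r) :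
    Equimeasurable m₁ m₂ (fun x => u₁ x ^ r) (fun x => u₂ x ^ r) := by
  intro s
  have : ∀ c : ℝ≥0∞, s < c ^ r ↔ s ^ r⁻¹ < c := fun c => by
    rw [ENNReal.rpow_inv_lt_iff hr]
  simp only [this]
  exact h _

/-- Layer cake for finite q; for q = ∞ the essential supremum is the infimum of the levels with null
superlevel set. -/
theorem Equimeasurable.eLpNorm_eq [SFinite m₁] [SFinite m₂] (h : Equimeasurable m₁ m₂ u₁ u₂)
    (h₁ : AEMeasurable u₁ m₁) (h₂ : AEMeasurable u₂ m₂) (q : ℝ≥0∞) :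
    eLpNorm u₁ q m₁ = eLpNorm u₂ q m₂ := by
  rcases eq_or_ne q 0 with rfl | h0
  · simp
  rcases eq_or_ne q ∞ with rfl | ht
  · simp only [eLpNorm_exponent_top, eLpNormEssSup, essSup_eq_sInf, enorm_eq_self]
    congr 1; ext s
    exact iff_of_eq (congrArg (· = 0) (h s))
  · rw [eLpNorm_eq_lintegral_rpow_enorm_toReal h0 ht, eLpNorm_eq_lintegral_rpow_enorm_toReal h0 ht]
    simp only [enorm_eq_self]
    congr 1
    exact (h.rpow (ENNReal.toReal_pos h0 ht)).lintegral_eq (h₁.pow_const _) (h₂.pow_const _)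

end Equimeasurable

/-! ### Primitives as functions of the endpoint -/

/-- The primitive `c ↦ ∫_0^c f`. -/
noncomputable def primitive (f : ℝ → ℝ≥0∞) (c : ℝ≥0∞) : ℝ≥0∞ := ∫⁻ t in initialInterval c, f t

theorem primitive_mono (f : ℝ → ℝ≥0∞) : Monotone (primitive f) := fun _ _ h =>
  lintegral_mono_set (initialInterval_mono h)

theorem primitive_zero (f : ℝ → ℝ≥0∞) : primitive f 0 = 0 := by
  simp [primitive, initialInterval]

/-- The primitive is left continuous. -/
theorem exists_lt_lt_primitive {f : ℝ → ℝ≥0∞} {s c : ℝ≥0∞} (h : s < primitive f c) :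
    ∃ c' < c, s < primitive f c' := by
  have hc : 0 < c := by
    rw [pos_iff_ne_zero]; rintro rfl; rw [primitive_zero] at h; exact not_lt_zero h
  obtain ⟨v, hv, hvc, hlim⟩ := exists_seq_strictMono_tendsto' hc
  have hU : initialInterval c = ⋃ n, initialInterval (v n) := by
    refine Subset.antisymm (fun t ht => ?_)
      (iUnion_subset fun n => initialInterval_mono (hvc n).2.le)
    obtain ⟨n, hn⟩ := (hlim.eventually (lt_mem_nhds ht.2)).exists
    exact mem_iUnion.2 ⟨n, ht.1, hn⟩
  have hdir : Directed (· ⊆ ·) fun n => initialInterval (v n) :=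
    Monotone.directed_le fun i j hij => initialInterval_mono (hv.monotone hij)
  rw [primitive, hU, setLIntegral_iUnion_of_directed _ hdir, lt_iSup_iff] at h
  obtain ⟨n, hn⟩ := h
  exact ⟨v n, (hvc n).2, hn⟩

/-- Monotonicity and left continuity make every superlevel set an open ray, so superlevel sets of a
composite with `primitive f` are superlevel sets of the inner function. If the level is never
exceeded, the threshold is `sInf ∅ = ∞`. -/
theorem exists_lt_primitive_iff (f : ℝ → ℝ≥0∞) (s : ℝ≥0∞) :
    ∃ c₀, ∀ c, s < primitive f c ↔ c₀ < c := by
  refine ⟨sInf {c | s < primitive f c}, fun c => ?_⟩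
  rw [sInf_lt_iff]
  constructor
  · intro h
    obtain ⟨c', h1, h2⟩ := exists_lt_lt_primitive h
    exact ⟨c', h2, h1⟩
  · rintro ⟨c', h1, h2⟩
    exact lt_of_lt_of_le h1 (primitive_mono f h2.le)

theorem measurable_primitive (f : ℝ → ℝ≥0∞) : Measurable (primitive f) :=
  (primitive_mono f).measurable

theorem Equimeasurable.primitive_comp {X₁ X₂ : Type*} [MeasurableSpace X₁] [MeasurableSpace X₂]
    {m₁ : Measure X₁} {m₂ : Measure X₂} {u₁ : X₁ → ℝ≥0∞} {u₂ : X₂ → ℝ≥0∞}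
    (h : Equimeasurable m₁ m₂ u₁ u₂) (f : ℝ → ℝ≥0∞) :
    Equimeasurable m₁ m₂ (fun x => primitive f (u₁ x)) (fun x => primitive f (u₂ x)) := by
  intro s
  obtain ⟨c₀, hc⟩ := exists_lt_primitive_iff f s
  simp only [hc]
  exact h _

/-! ### The non-increasing rearrangement -/

section Rearrangement

variable {X : Type*} [MeasurableSpace X] (m : Measure X) (u : X → ℝ≥0∞)

theorem rearrangement_antitone : Antitone (rearrangement m u) := by
  intro x y hxy
  refine iSup_mono fun t => iSup_mono fun _ => iSup_le fun h => ?_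
  exact le_iSup_of_le ((ENNReal.ofReal_le_ofReal hxy).trans_lt h) le_rfl

/-- The distribution function is right continuous, by continuity of the measure from below; hence a
strict inequality at s persists at some slightly larger real level. -/
theorem lt_rearrangement_iff (x : ℝ) (s : ℝ≥0∞) :
    s < rearrangement m u x ↔ ENNReal.ofReal x < m {z | s < u z} := by
  simp only [rearrangement, generalizedInverse, distributionFunction, lt_iSup_iff]
  constructor
  · rintro ⟨t, _, h, hs⟩
    exact h.trans_le (measure_mono fun z hz => hs.trans hz)
  · intro h
    rcases eq_or_ne s ∞ with rfl | hs
    · simp at h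
    obtain ⟨v, hv, hvs, hlim⟩ := exists_seq_strictAnti_tendsto' hs.lt_top
    have hU : {z | s < u z} = ⋃ n, {z | v n < u z} := by
      refine Subset.antisymm (fun z hz => ?_) (iUnion_subset fun n z hz => (hvs n).1.trans hz)
      obtain ⟨n, hn⟩ := (hlim.eventually (gt_mem_nhds hz)).exists
      exact mem_iUnion.2 ⟨n, hn⟩
    have hmono : Monotone fun n => {z | v n < u z} := fun i j hij z hz =>
      lt_of_le_of_lt (hv.antitone hij) hz
    rw [hU, hmono.measure_iUnion, lt_iSup_iff] at h
    obtain ⟨n, hn⟩ := h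
    have hr : ENNReal.ofReal (v n).toReal = v n := ENNReal.ofReal_toReal (hvs n).2.ne
    refine ⟨(v n).toReal, ENNReal.toReal_pos ?_ (hvs n).2.ne, ?_, ?_⟩
    · exact (lt_of_le_of_lt (zero_le) (hvs n).1).ne'
    · rwa [hr]
    · rw [hr]; exact (hvs n).1

theorem initialInterval_meas_lt (s : ℝ≥0∞) :
    initialInterval (m {z | s < u z}) = {x | s < rearrangement m u x} ∩ Ioi 0 := by
  ext x
  simp [initialInterval, lt_rearrangement_iff, and_comm]

theorem measurable_rearrangement : Measurable (rearrangement m u) :=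
  (rearrangement_antitone m u).measurable

theorem equimeasurable_rearrangement : Equimeasurable m halfLine u (rearrangement m u) := by
  intro s
  rw [halfLine, Measure.restrict_apply (measurableSet_lt measurable_const
    (measurable_rearrangement m u)), ← initialInterval_meas_lt, volume_initialInterval]

/-- The Hardy–Littlewood inequality for integrals over a set. -/
theorem setLIntegral_le_primitive_rearrangement [SFinite m] {g : X → ℝ≥0∞} (hg : Measurable g)
    (E : Set X) : ∫⁻ x in E, g x ∂m ≤ primitive (rearrangement m g) (m E) := by
  rw [primitive, lintegral_eq_lintegral_halfLine_meas_lt _ hg.aemeasurable,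
    lintegral_eq_lintegral_halfLine_meas_lt _ (measurable_rearrangement m g).aemeasurable]
  refine lintegral_mono fun t => ?_
  rw [Measure.restrict_apply (measurableSet_lt measurable_const hg),
    Measure.restrict_apply (measurableSet_lt measurable_const (measurable_rearrangement m g))]
  have h : {x | ENNReal.ofReal t < rearrangement m g x} ∩ initialInterval (m E) =
      initialInterval (min (m {x | ENNReal.ofReal t < g x}) (m E)) := by
    rw [← initialInterval_inter, initialInterval_meas_lt, inter_assoc,
      inter_eq_right.2 (initialInterval_subset_Ioi (m E))]
  rw [h, volume_initialInterval]
  exact le_min (measure_mono inter_subset_left) (measure_mono inter_subset_right)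

end Rearrangement

/-! ### Monotone convergence and Jensen in L^q -/

/-- Monotone convergence needs no triangle inequality, so exponents below 1 are included. -/
theorem eLpNorm_iSup_le {X : Type*} [MeasurableSpace X] {m : Measure X} {u : ℕ → X → ℝ≥0∞}
    (hu : ∀ n, AEMeasurable (u n) m) (hmono : ∀ x, Monotone fun n => u n x) {q A : ℝ≥0∞}
    (hA : ∀ n, eLpNorm (u n) q m ≤ A) : eLpNorm (fun x => ⨆ n, u n x) q m ≤ A := by
  rcases eq_or_ne q 0 with rfl | h0
  · simp
  rcases eq_or_ne q ∞ with rfl | ht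
  · simp only [eLpNorm_exponent_top, eLpNormEssSup, enorm_eq_self] at hA ⊢
    refine essSup_le_of_ae_le _ ?_
    have : ∀ᵐ x ∂m, ∀ n, u n x ≤ A := ae_all_iff.2 fun n =>
      (ae_le_essSup (f := u n)).mono fun x hx => hx.trans (hA n)
    filter_upwards [this] with x hx using iSup_le hx
  · have hq := ENNReal.toReal_pos h0 ht
    simp only [eLpNorm_eq_lintegral_rpow_enorm_toReal h0 ht, enorm_eq_self] at hA ⊢
    have hpow : ∀ x, (⨆ n, u n x) ^ q.toReal = ⨆ n, u n x ^ q.toReal := fun x =>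
      (ENNReal.orderIsoRpow q.toReal hq).map_iSup _
    simp only [hpow]
    rw [lintegral_iSup' (fun n => (hu n).pow_const _)
      (ae_of_all _ fun x i j hij => ENNReal.rpow_le_rpow (hmono x hij) hq.le)]
    simp only [one_div, ENNReal.rpow_inv_le_iff hq] at hA ⊢
    exact iSup_le hA

/-- Jensen's inequality for the average of a function over a set of finite measure. -/
theorem rpow_average_mul_le {X : Type*} [MeasurableSpace X] {m : Measure X} {f : X → ℝ≥0∞}
    (hf : AEMeasurable f m) (hm : m univ ≠ ∞) {r : ℝ} (hr : 1 ≤ r) :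
    ((∫⁻ x, f x ∂m) * (m univ)⁻¹) ^ r * m univ ≤ ∫⁻ x, f x ^ r ∂m := by
  have hr0 : 0 < r := one_pos.trans_le hr
  rcases eq_or_ne (m univ) 0 with h0 | h0
  · simp [h0]
  have key := eLpNorm'_le_eLpNorm'_mul_rpow_measure_univ one_pos hr hf.aestronglyMeasurable
  simp only [eLpNorm', enorm_eq_self, ENNReal.rpow_one, div_one] at key
  have key2 := ENNReal.rpow_le_rpow key hr0.le
  rw [ENNReal.mul_rpow_of_nonneg _ _ hr0.le, ← ENNReal.rpow_mul, ← ENNReal.rpow_mul,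
    one_div_mul_cancel hr0.ne', ENNReal.rpow_one] at key2
  rw [ENNReal.mul_rpow_of_nonneg _ _ hr0.le]
  calc _ ≤ (∫⁻ x, f x ^ r ∂m) * m univ ^ ((1 - 1 / r) * r) * (m univ)⁻¹ ^ r * m univ := by gcongr
    _ = (∫⁻ x, f x ^ r ∂m) * m univ ^ ((1 - 1 / r) * r + -r + 1) := by
      rw [ENNReal.rpow_add _ _ h0 hm, ENNReal.rpow_add _ _ h0 hm, ENNReal.rpow_neg,
        ENNReal.inv_rpow, ENNReal.rpow_one]
      ring
    _ = _ := by
      have : (1 - 1 / r) * r + -r + 1 = 0 := by field_simp; ring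
      rw [this, ENNReal.rpow_zero, mul_one]

/-! ### Equality of the best constants -/

section Hardy

variable {S Y : Type*} [MeasurableSpace S] [MeasurableSpace Y] {lam : Measure S} {mu : Measure Y}
  {B : Y → Set S}

omit [MeasurableSpace Y] in
theorem abstractHardy_le_primitive_rearrangement [SFinite lam] {g : S → ℝ≥0∞} (hg : Measurable g)
    (y : Y) : abstractHardy lam B g y ≤ primitive (rearrangement lam g) (lam (B y)) :=
  setLIntegral_le_primitive_rearrangement lam hg _

omit [MeasurableSpace Y] in
-- On a chain, ordering by measure agrees with inclusion up to null sets: if inclusion goes the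
-- other way, the two sets have equal finite measure.
theorem measure_diff_eq_zero_of_chain (hmeas : ∀ y, MeasurableSet (B y))
    (hchain : IsChain (· ⊆ ·) (range B)) {y z : Y} (hz : lam (B z) ≠ ∞)
    (h : lam (B z) ≤ lam (B y)) : lam (B z \ B y) = 0 := by
  rcases hchain.total (mem_range_self z) (mem_range_self y) with hzy | hyz
  · rw [sdiff_eq_empty.2 hzy, measure_empty]
  · rw [measure_sdiff hyz (hmeas y).nullMeasurableSet (measure_ne_top_of_subset hyz hz),
      tsub_eq_zero_of_le h]

omit [MeasurableSpace Y] in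
/-- Averaging `f` over the gaps of a finite subchain of the core. -/
theorem exists_average (hmeas : ∀ y, MeasurableSet (B y))
    (hchain : IsChain (· ⊆ ·) (range B)) (hfin : ∀ y, lam (B y) ≠ ∞) {f : ℝ → ℝ≥0∞}
    (hf : Measurable f) (t : Finset Y) :
    ∃ g : S → ℝ≥0∞, Measurable g ∧ (∀ s ∉ ⋃ z ∈ t, B z, g s = 0) ∧
      (∀ s, g s ≤ essSup f halfLine) ∧
      (∫⁻ s, g s ∂lam = primitive f (lam (⋃ z ∈ t, B z))) ∧
      (∀ z ∈ t, ∫⁻ s in B z, g s ∂lam = primitive f (lam (B z))) ∧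
      ∀ r : ℝ, 1 ≤ r → ∫⁻ s, g s ^ r ∂lam ≤ primitive (fun x => f x ^ r) (lam (⋃ z ∈ t, B z)) := by
  classical
  -- Core sets are added in order of increasing measure, so each new one contains the union of the
  -- earlier ones up to a null set.
  induction t using Finset.induction_on_max_value (fun y => lam (B y)) with
  | empty =>
    refine ⟨0, measurable_zero, by simp, by simp, by simp [primitive_zero], by simp, ?_⟩
    intro r hr
    simp [ENNReal.zero_rpow_of_pos (one_pos.trans_le hr)]
  | insert y t hy hmax ih =>
    obtain ⟨g, hg, hsupp, hsup, hint, hintB, hpow⟩ := ih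
    set E : Set S := ⋃ z ∈ t, B z with hE
    have hEm : MeasurableSet E := t.measurableSet_biUnion fun z _ => hmeas z
    have hEy : lam (E \ B y) = 0 := by
      have : E \ B y = ⋃ z ∈ t, B z \ B y := by
        ext s; simp only [hE, Set.mem_sdiff, mem_iUnion, exists_prop, and_assoc,
          ← exists_and_right]
      rw [this]
      exact (measure_biUnion_null_iff t.countable_toSet).2 fun z hz =>
        measure_diff_eq_zero_of_chain hmeas hchain (hfin z) (hmax z hz)
    set A : Set S := B y \ E with hA
    have hAm : MeasurableSet A := (hmeas y).diff hEm
    have hU : ⋃ z ∈ insert y t, B z = A ∪ E := by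
      rw [Finset.set_biUnion_insert, hA, sdiff_union_self]
    have hlamU : lam (A ∪ E) = lam (B y) := by
      rw [hA, sdiff_union_self, ← union_sdiff_self]
      refine le_antisymm ((measure_union_le _ _).trans (by rw [hEy, add_zero])) ?_
      exact measure_mono subset_union_left
    have hadd : lam A + lam E = lam (B y) := by
      rw [← hlamU, measure_union disjoint_sdiff_left hEm]
    have hEfin : lam E ≠ ∞ := ne_top_of_le_ne_top (hfin y) (hadd ▸ le_add_self)
    have hAfin : lam A ≠ ∞ := ne_top_of_le_ne_top (hfin y) (hadd ▸ le_self_add)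
    set I : Set ℝ := initialInterval (lam (B y)) \ initialInterval (lam E) with hI
    have hsub : initialInterval (lam E) ⊆ initialInterval (lam (B y)) :=
      initialInterval_mono (hadd ▸ le_add_self)
    have hvolI : volume I = lam A := by
      rw [hI, measure_sdiff hsub (measurableSet_initialInterval _).nullMeasurableSet
        (by rwa [volume_initialInterval]), volume_initialInterval, volume_initialInterval, ← hadd,
        ENNReal.add_sub_cancel_right hEfin]
    have hsplit : ∀ h : ℝ → ℝ≥0∞,
        primitive h (lam E) + ∫⁻ x in I, h x = primitive h (lam (B y)) := fun h => by
      rw [primitive, primitive, ← lintegral_inter_add_sdiff h (initialInterval (lam (B y)))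
        (measurableSet_initialInterval (lam E)), inter_eq_right.2 hsub]
    -- The mean of f over the new interval, to be spread over the new gap A. If A is null then so is
    -- I, and the convention 0 · ∞ = 0 gives a = 0.
    set a : ℝ≥0∞ := (∫⁻ x in I, f x) * (lam A)⁻¹ with ha
    have haA : a * lam A = ∫⁻ x in I, f x := by
      rcases eq_or_ne (lam A) 0 with h0 | h0
      · rw [h0, mul_zero, setLIntegral_measure_zero _ _ (hvolI.trans h0)]
      · rw [ha, mul_assoc, ENNReal.inv_mul_cancel h0 hAfin, mul_one]
    have haM : a ≤ essSup f halfLine := by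
      have hle : ∫⁻ x in I, f x ≤ essSup f halfLine * lam A := by
        rw [← hvolI, ← setLIntegral_const]
        refine lintegral_mono_ae ?_
        have : volume.restrict I ≤ halfLine := Measure.restrict_mono
          (sdiff_subset.trans (initialInterval_subset_Ioi _)) le_rfl
        exact ae_mono this (ae_le_essSup (f := f))
      calc a ≤ essSup f halfLine * lam A * (lam A)⁻¹ := by rw [ha]; gcongr
        _ = essSup f halfLine * (lam A * (lam A)⁻¹) := mul_assoc _ _ _
        _ ≤ essSup f halfLine * 1 := mul_le_mul_right (ENNReal.mul_inv_le_one _) _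
        _ = _ := mul_one _
    have hgA : ∀ s ∈ A, g s = 0 := fun s hs => hsupp s hs.2
    have hgc : ∫⁻ s in (B y)ᶜ, g s ∂lam = 0 := by
      refine (setLIntegral_eq_zero_iff (hmeas y).compl hg).2 ?_
      have : ∀ᵐ s ∂lam, s ∉ E \ B y := measure_eq_zero_iff_ae_notMem.1 hEy
      filter_upwards [this] with s hs hsy
      exact hsupp s fun h => hs ⟨h, hsy⟩
    have hgy : ∫⁻ s in B y, g s ∂lam = primitive f (lam E) := by
      rw [← hint, ← lintegral_add_compl (μ := lam) g (hmeas y), hgc, add_zero]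
    refine ⟨fun s => g s + A.indicator (fun _ => a) s, hg.add (measurable_const.indicator hAm),
      ?_, ?_, ?_, ?_, ?_⟩
    · intro s hs
      rw [hU] at hs
      beta_reduce
      rw [hsupp s fun h => hs (Or.inr h), indicator_of_notMem fun h => hs (Or.inl h), add_zero]
    · intro s
      by_cases hs : s ∈ A
      · simpa [hgA s hs, hs] using haM
      · simpa [hs] using hsup s
    · rw [lintegral_add_left hg, lintegral_indicator_const hAm, haA, hint, hsplit, hU, hlamU]
    · intro z hz
      rw [lintegral_add_left hg, lintegral_indicator_const hAm, Measure.restrict_apply hAm]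
      rcases Finset.mem_insert.1 hz with rfl | hz
      · rw [inter_eq_left.2 (show A ⊆ B z from sdiff_subset), haA, hgy, hsplit]
      · have : A ∩ B z = ∅ := by
          refine (disjoint_left.2 fun s hs hsz => hs.2 ?_).inter_eq
          exact mem_iUnion₂.2 ⟨z, hz, hsz⟩
        rw [this, measure_empty, mul_zero, add_zero, hintB z hz]
    · intro r hr
      have hr0 : 0 < r := one_pos.trans_le hr
      have hsum : ∀ s, (g s + A.indicator (fun _ => a) s) ^ r =
          g s ^ r + A.indicator (fun _ => a ^ r) s := fun s => by
        by_cases hs : s ∈ A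
        · simp [hgA s hs, hs, ENNReal.zero_rpow_of_pos hr0]
        · simp [hs]
      simp only [hsum]
      rw [lintegral_add_left (hg.pow_const r), lintegral_indicator_const hAm, hU, hlamU, ← hsplit]
      refine add_le_add (hpow r hr) ?_
      have := rpow_average_mul_le (m := volume.restrict I) hf.aemeasurable
        (by rwa [Measure.restrict_apply_univ, hvolI]) hr
      rwa [Measure.restrict_apply_univ, hvolI] at this

omit [MeasurableSpace Y] in
theorem exists_average_eLpNorm_le (hmeas : ∀ y, MeasurableSet (B y))
    (hchain : IsChain (· ⊆ ·) (range B)) (hfin : ∀ y, lam (B y) ≠ ∞) {p : ℝ≥0∞} (hp : 1 ≤ p)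
    {f : ℝ → ℝ≥0∞} (hf : Measurable f) (t : Finset Y) :
    ∃ g : S → ℝ≥0∞, Measurable g ∧ eLpNorm g p lam ≤ eLpNorm f p halfLine ∧
      ∀ z ∈ t, abstractHardy lam B g z = primitive f (lam (B z)) := by
  obtain ⟨g, hg, -, hsup, -, hB, hpow⟩ := exists_average (lam := lam) hmeas hchain hfin hf t
  refine ⟨g, hg, ?_, hB⟩
  rcases eq_or_ne p ∞ with rfl | ht
  · simp only [eLpNorm_exponent_top, eLpNormEssSup, enorm_eq_self]
    exact essSup_le_of_ae_le _ (ae_of_all _ hsup)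
  · have h0 : p ≠ 0 := (one_pos.trans_le hp).ne'
    rw [eLpNorm_eq_lintegral_rpow_enorm_toReal h0 ht, eLpNorm_eq_lintegral_rpow_enorm_toReal h0 ht]
    simp only [enorm_eq_self]
    gcongr
    refine (hpow p.toReal (by simpa using ENNReal.toReal_mono ht hp)).trans ?_
    exact lintegral_mono_set (initialInterval_subset_Ioi _)

omit [MeasurableSpace Y] in
/-- Countably many points suffice to recover a monotone function of `φ` as a supremum. -/
theorem exists_countable_coinitial (φ F : Y → ℝ≥0∞) :
    ∃ D : Set Y, D.Countable ∧ ∀ y, ∀ s < F y, ∃ d ∈ D, φ d ≤ φ y ∧ s < F d := by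
  have hex : ∀ r : ℚ, ∃ D : Set Y, D.Countable ∧
      ∀ y, ENNReal.ofReal r < F y → ∃ d ∈ D, φ d ≤ φ y ∧ ENNReal.ofReal r < F d := by
    intro r
    set A : Set Y := {y | ENNReal.ofReal r < F y}
    rcases A.eq_empty_or_nonempty with hA | hA
    · exact ⟨∅, countable_empty, fun y hy => absurd hy (hA ▸ notMem_empty y : y ∉ A)⟩
    obtain ⟨u, -, hu, hmem⟩ := exists_seq_tendsto_sInf (hA.image φ) (OrderBot.bddBelow _)
    choose v hvA hv using hmem
    -- If the infimum of φ on {F > r} is attained, one point serves every y; otherwise a minimizing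
    -- sequence eventually drops below φ y.
    by_cases hmin : ∃ d ∈ A, φ d = sInf (φ '' A)
    · obtain ⟨d, hd, hde⟩ := hmin
      exact ⟨{d}, countable_singleton d, fun y hy => ⟨d, rfl, hde ▸ sInf_le ⟨y, hy, rfl⟩, hd⟩⟩
    · refine ⟨range v, countable_range v, fun y hy => ?_⟩
      have hlt : sInf (φ '' A) < φ y := lt_of_le_of_ne (sInf_le ⟨y, hy, rfl⟩)
        fun h => hmin ⟨y, hy, h.symm⟩
      obtain ⟨n, hn⟩ := (hu.eventually (gt_mem_nhds hlt)).exists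
      exact ⟨v n, mem_range_self n, (hv n).trans_le hn.le, hvA n⟩
  choose D hD h using hex
  refine ⟨⋃ r, D r, countable_iUnion hD, fun y s hs => ?_⟩
  obtain ⟨r, -, hsr, hry⟩ := ENNReal.lt_iff_exists_rat_btwn.1 hs
  obtain ⟨d, hd, hdy, hdF⟩ := h r y hry
  exact ⟨d, mem_iUnion.2 ⟨r, hd⟩, hdy, lt_trans hsr hdF⟩

theorem hardyInequality_primitive_of_abstractHardy (hmeas : ∀ y, MeasurableSet (B y))
    (hchain : IsChain (· ⊆ ·) (range B)) (hφ : AEMeasurable (fun y => lam (B y)) mu)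
    (hfin : ∀ y, lam (B y) ≠ ∞) {p q C : ℝ≥0∞} (hp : 1 ≤ p)
    (h : HardyInequality lam mu (abstractHardy lam B) p q C) :
    HardyInequality halfLine mu (fun f y => primitive f (lam (B y))) p q C := by
  classical
  intro f hf
  rcases isEmpty_or_nonempty Y with hY | ⟨⟨y₀⟩⟩
  · simp [Measure.eq_zero_of_isEmpty mu]
  obtain ⟨D, hD, hDF⟩ := exists_countable_coinitial (fun y => lam (B y))
    (fun y => primitive f (lam (B y)))
  obtain ⟨d, hd⟩ := (hD.insert y₀).exists_eq_range (insert_nonempty _ _)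
  -- Step functions of r = λ(B(y)) using only the first n sample points. They increase in n, their
  -- supremum at λ(B(y)) dominates the primitive there, and each lies below K_B g for the g matched
  -- at those points.
  set u : ℕ → ℝ≥0∞ → ℝ≥0∞ := fun n r =>
    ⨆ i < n, if lam (B (d i)) ≤ r then primitive f (lam (B (d i))) else 0 with hu
  have hum : ∀ n, Measurable (u n) := fun n => by
    refine Measurable.iSup fun i => Measurable.iSup fun _ => ?_
    exact Measurable.ite measurableSet_Ici measurable_const measurable_const
  have hmono : ∀ r, Monotone fun n => u n r := fun r m n hmn =>
    biSup_mono fun i hi => lt_of_lt_of_le hi hmn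
  have hle : ∀ y, primitive f (lam (B y)) ≤ ⨆ n, u n (lam (B y)) := by
    refine fun y => le_of_forall_lt fun s hs => ?_
    obtain ⟨z, hz, hzy, hsz⟩ := hDF y s hs
    obtain ⟨i, rfl⟩ : z ∈ range d := hd ▸ mem_insert_of_mem _ hz
    refine hsz.trans_le (le_iSup_of_le (i + 1) (le_iSup₂_of_le i i.lt_succ_self ?_))
    rw [if_pos hzy]
  refine (eLpNorm_mono_enorm (by simpa using hle)).trans
    (eLpNorm_iSup_le (fun n => (hum n).comp_aemeasurable hφ) (fun y => hmono _) fun n => ?_)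
  obtain ⟨g, hg, hgf, hgd⟩ := exists_average_eLpNorm_le (lam := lam) hmeas hchain hfin hp hf
    ((Finset.range n).image d)
  calc eLpNorm (fun y => u n (lam (B y))) q mu ≤ eLpNorm (abstractHardy lam B g) q mu := by
        refine eLpNorm_mono_enorm fun y => ?_
        simp only [enorm_eq_self]
        refine iSup₂_le fun i hi => ?_
        split_ifs with hiy
        · rw [← hgd (d i) (Finset.mem_image_of_mem d (Finset.mem_range.2 hi))]
          have h0 := measure_diff_eq_zero_of_chain hmeas hchain (hfin (d i)) hiy
          exact lintegral_mono' (Measure.restrict_mono_ae (ae_le_set.2 h0)) le_rfl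
        · exact zero_le
    _ ≤ C * eLpNorm g p lam := h g hg
    _ ≤ C * eLpNorm f p halfLine := by gcongr

theorem hardyInequality_abstractHardy_of_primitive [SFinite lam] {p q C : ℝ≥0∞}
    (h : HardyInequality halfLine mu (fun f y => primitive f (lam (B y))) p q C) :
    HardyInequality lam mu (abstractHardy lam B) p q C := by
  intro g hg
  calc eLpNorm (abstractHardy lam B g) q mu
      ≤ eLpNorm (fun y => primitive (rearrangement lam g) (lam (B y))) q mu :=
        eLpNorm_mono_enorm fun y => by
          simpa using abstractHardy_le_primitive_rearrangement hg y
    _ ≤ C * eLpNorm (rearrangement lam g) p halfLine := h _ (measurable_rearrangement lam g)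
    _ = C * eLpNorm g p lam := by
        rw [(equimeasurable_rearrangement lam g).eLpNorm_eq hg.aemeasurable
          (measurable_rearrangement lam g).aemeasurable]

/-- A Hardy inequality only depends on the distribution of the measures of the core sets. -/
theorem hardyInequality_iff_of_equimeasurable {X : Type*} [MeasurableSpace X] {m : Measure X}
    [SFinite m] [SFinite lam] [SFinite mu] (hmeas : ∀ y, MeasurableSet (B y))
    (hchain : IsChain (· ⊆ ·) (range B)) (hφ : AEMeasurable (fun y => lam (B y)) mu)
    (hfin : ∀ y, lam (B y) ≠ ∞) {b : X → ℝ≥0∞} (hb : AEMeasurable b m)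
    (heq : Equimeasurable mu m (fun y => lam (B y)) b) {p q C : ℝ≥0∞} (hp : 1 ≤ p) :
    HardyInequality lam mu (abstractHardy lam B) p q C ↔
      HardyInequality halfLine m (fun f x => primitive f (b x)) p q C := by
  have key : HardyInequality halfLine mu (fun f y => primitive f (lam (B y))) p q C ↔
      HardyInequality halfLine m (fun f x => primitive f (b x)) p q C := by
    refine forall_congr' fun f => imp_congr_right fun _ => ?_
    rw [(heq.primitive_comp f).eLpNorm_eq ((measurable_primitive f).comp_aemeasurable hφ)
      ((measurable_primitive f).comp_aemeasurable hb)]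
  rw [← key]
  exact ⟨hardyInequality_primitive_of_abstractHardy hmeas hchain hφ hfin hp,
    hardyInequality_abstractHardy_of_primitive⟩

end Hardy

/-! ### Compact operators into L^q -/

/-- An operator dominated, up to small multiples of the norm, by operators of finite rank
is compact. -/
theorem isCompactOperator_of_forall_le {E F : Type*} [NormedAddCommGroup E] [NormedSpace ℂ E]
    [NormedAddCommGroup F] [NormedSpace ℂ F] [CompleteSpace F] (L : E →L[ℂ] F)
    (h : ∀ ε : ℝ, 0 < ε → ∃ (n : ℕ) (T : E →L[ℂ] (Fin n → ℂ)) (M : ℝ), 0 ≤ M ∧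
      ∀ x, ‖L x‖ ≤ ε * ‖x‖ + M * ‖T x‖) : IsCompactOperator L := by
  refine (isCompactOperator_iff_isCompact_closure_image_closedBall L.toLinearMap one_pos).2 ?_
  refine TotallyBounded.isCompact_of_isClosed (TotallyBounded.closure ?_) isClosed_closure
  rw [Metric.totallyBounded_iff]
  intro δ hδ
  -- Points of the unit ball differ by at most 2, costing δ/2; the finite rank term costs another
  -- δ/4. The radius below uses M + 1 to avoid dividing by zero.
  obtain ⟨n, T, M, hM, hLT⟩ := h (δ / 4) (by positivity)
  have hTB : TotallyBounded (T '' Metric.closedBall 0 1) :=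
    (Metric.isCompact_of_isClosed_isBounded isClosed_closure
      (T.lipschitz.isBounded_image Metric.isBounded_closedBall).closure).totallyBounded.subset
        subset_closure
  obtain ⟨t, ht, htf, hcov⟩ := Metric.finite_approx_of_totallyBounded hTB (δ / (4 * (M + 1)))
    (by positivity)
  obtain ⟨t', ht', htf', rfl⟩ := exists_subset_image_finite_and.1 ⟨t, ht, htf, rfl⟩
  refine ⟨L '' t', htf'.image _, ?_⟩
  rintro _ ⟨x, hx, rfl⟩
  obtain ⟨_, ⟨z, hz, rfl⟩, hxz⟩ := mem_iUnion₂.1 (hcov ⟨x, hx, rfl⟩)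
  refine mem_iUnion₂.2 ⟨L z, mem_image_of_mem _ hz, ?_⟩
  rw [Metric.mem_ball, dist_eq_norm] at hxz ⊢
  have h1 : ‖x - z‖ ≤ 2 := by
    have hx1 := mem_closedBall_zero_iff.1 hx
    have hz1 := mem_closedBall_zero_iff.1 (ht' hz)
    linarith [norm_sub_le x z]
  have h2 := hLT (x - z)
  rw [map_sub, map_sub] at h2
  have h3 : M * ‖T x - T z‖ ≤ δ / 4 := by
    calc M * ‖T x - T z‖ ≤ (M + 1) * (δ / (4 * (M + 1))) := by gcongr; linarith
      _ = δ / 4 := by field_simp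
  calc ‖L x - L z‖ ≤ δ / 4 * ‖x - z‖ + M * ‖T x - T z‖ := h2
    _ ≤ δ / 4 * 2 + δ / 4 := by gcongr
    _ < δ := by linarith

/-- The measure |h|^q dμ is finite, hence continuous from above along the sets Z n. -/
theorem tendsto_eLpNorm_restrict_zero {Y : Type*} [MeasurableSpace Y] {mu : Measure Y}
    {h : Y → ℂ} {q : ℝ≥0∞} (h0 : q ≠ 0) (ht : q ≠ ∞) (hh : MemLp h q mu) {Z : ℕ → Set Y}
    (hZ : Antitone Z) (hZm : ∀ n, MeasurableSet (Z n)) (hZ0 : mu (⋂ n, Z n) = 0) :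
    Tendsto (fun n => eLpNorm h q (mu.restrict (Z n))) atTop (𝓝 0) := by
  have hq := ENNReal.toReal_pos h0 ht
  set w : Y → ℝ≥0∞ := fun y => ‖h y‖ₑ ^ q.toReal with hw
  have hfin : mu.withDensity w univ ≠ ∞ := by
    rw [withDensity_apply _ MeasurableSet.univ, Measure.restrict_univ]
    exact (lintegral_rpow_enorm_lt_top_of_eLpNorm_lt_top h0 ht hh.2).ne
  have hlim : Tendsto (fun n => mu.withDensity w (Z n)) atTop (𝓝 0) := by
    have := tendsto_measure_iInter_atTop (μ := mu.withDensity w)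
      (fun n => (hZm n).nullMeasurableSet) hZ ⟨0, measure_ne_top_of_subset (subset_univ _) hfin⟩
    rwa [withDensity_absolutelyContinuous mu w hZ0] at this
  have hpow := hlim.ennrpow_const (1 / q.toReal)
  rw [ENNReal.zero_rpow_of_pos (by positivity)] at hpow
  refine hpow.congr fun n => ?_
  rw [eLpNorm_eq_lintegral_rpow_enorm_toReal h0 ht, withDensity_apply _ (hZm n)]

theorem norm_LpToLpRestrictCLM_le {Y : Type*} [MeasurableSpace Y] {mu : Measure Y} {q : ℝ≥0∞}
    [Fact (1 ≤ q)] (Z : Set Y) (f : Lp ℂ q mu) : ‖LpToLpRestrictCLM Y ℂ ℂ mu q Z f‖ ≤ ‖f‖ := by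
  rw [Lp.norm_def, Lp.norm_def, eLpNorm_congr_ae (LpToLpRestrictCLM_coeFn ℂ Z f)]
  exact ENNReal.toReal_mono (Lp.eLpNorm_ne_top f)
    (eLpNorm_mono_measure _ Measure.restrict_le_self)

/-- The image of the unit ball under a compact operator into `L^q` has uniformly small tails. -/
theorem exists_norm_restrict_le_of_isCompactOperator {E Y : Type*} [NormedAddCommGroup E]
    [NormedSpace ℂ E] [MeasurableSpace Y] {mu : Measure Y} {q : ℝ≥0∞} [Fact (1 ≤ q)] (ht : q ≠ ∞)
    {L : E →L[ℂ] Lp ℂ q mu} (hL : IsCompactOperator L) {Z : ℕ → Set Y}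
    (hZ : Antitone Z) (hZm : ∀ n, MeasurableSet (Z n)) (hZ0 : mu (⋂ n, Z n) = 0) {ε : ℝ}
    (hε : 0 < ε) : ∃ n, ∀ x, ‖LpToLpRestrictCLM Y ℂ ℂ mu q (Z n) (L x)‖ ≤ ε * ‖x‖ := by
  have h0 : q ≠ 0 := (one_pos.trans_le (Fact.out : 1 ≤ q)).ne'
  have hc := (isCompactOperator_iff_isCompact_closure_image_closedBall L.toLinearMap one_pos).1 hL
  obtain ⟨t, htf, hcov⟩ :=
    Metric.totallyBounded_iff.1 (hc.totallyBounded.subset subset_closure) (ε / 2) (half_pos hε)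
  -- A finite ε/2-net has uniformly small tails, and restriction is a contraction, so the tails of
  -- all other image points follow.
  have hev : ∀ᶠ n in atTop, ∀ y ∈ t, ‖LpToLpRestrictCLM Y ℂ ℂ mu q (Z n) y‖ ≤ ε / 2 := by
    refine (eventually_all_finite htf).2 fun y _ => ?_
    have hlim := tendsto_eLpNorm_restrict_zero h0 ht (Lp.memLp y) hZ hZm hZ0
    filter_upwards [hlim.eventually (gt_mem_nhds (ENNReal.ofReal_pos.2 (half_pos hε)))] with n hn
    rw [Lp.norm_def, eLpNorm_congr_ae (LpToLpRestrictCLM_coeFn ℂ (Z n) y)]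
    exact ENNReal.toReal_le_of_le_ofReal (half_pos hε).le hn.le
  obtain ⟨n, hn⟩ := hev.exists
  refine ⟨n, fun x => ?_⟩
  set R := LpToLpRestrictCLM Y ℂ ℂ mu q (Z n)
  have hunit : ∀ x, ‖x‖ = 1 → ‖(R.comp L) x‖ ≤ ε := fun x hx => by
    obtain ⟨y, hy, hxy⟩ := mem_iUnion₂.1 (hcov ⟨x, mem_closedBall_zero_iff.2 hx.le, rfl⟩)
    rw [Metric.mem_ball, dist_eq_norm] at hxy
    have hxy' : ‖L x - y‖ < ε / 2 := hxy
    calc ‖R (L x)‖ = ‖R (L x - y) + R y‖ := by rw [map_sub, sub_add_cancel]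
      _ ≤ ‖R (L x - y)‖ + ‖R y‖ := norm_add_le _ _
      _ ≤ ‖L x - y‖ + ε / 2 := add_le_add (norm_LpToLpRestrictCLM_le _ _) (hn y hy)
      _ ≤ ε := by linarith
  exact (R.comp L).le_of_opNorm_le (ContinuousLinearMap.opNorm_le_of_unit_norm hε.le hunit) x

/-! ### The Hardy operator on complex-valued functions -/

section Hardy

variable {S Y : Type*} [MeasurableSpace S] [MeasurableSpace Y] {lam : Measure S} {mu : Measure Y}
  {B : Y → Set S}

theorem setLIntegral_le_rpow_mul_eLpNorm {p : ℝ≥0∞} (hp : 1 ≤ p) {g : S → ℝ≥0∞}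
    (hg : AEMeasurable g lam) (E : Set S) :
    ∫⁻ s in E, g s ∂lam ≤ lam E ^ (1 - 1 / p.toReal) * eLpNorm g p lam := by
  have h := eLpNorm_le_eLpNorm_mul_rpow_measure_univ hp
    (hg.restrict (s := E)).aestronglyMeasurable
  rw [eLpNorm_one_eq_lintegral_enorm, Measure.restrict_apply_univ, mul_comm] at h
  simp only [enorm_eq_self, ENNReal.toReal_one, div_one] at h
  refine h.trans ?_
  gcongr
  exact Measure.restrict_le_self

omit [MeasurableSpace Y] in
theorem abstractHardy_mono_of_le (hmeas : ∀ y, MeasurableSet (B y))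
    (hchain : IsChain (· ⊆ ·) (range B)) (g : S → ℝ≥0∞) {y z : Y} (hz : lam (B z) ≠ ∞)
    (h : lam (B z) ≤ lam (B y)) : abstractHardy lam B g z ≤ abstractHardy lam B g y :=
  lintegral_mono' (Measure.restrict_mono_ae
    (ae_le_set.2 (measure_diff_eq_zero_of_chain hmeas hchain hz h))) le_rfl

/-- K_B g(y) depends monotonically on λ(B(y)) alone wherever the latter is finite, and monotone
functions on [0,∞] are Borel. -/
theorem aemeasurable_abstractHardy (hmeas : ∀ y, MeasurableSet (B y))
    (hchain : IsChain (· ⊆ ·) (range B)) (hφ : AEMeasurable (fun y => lam (B y)) mu)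
    (hfin : ∀ᵐ y ∂mu, lam (B y) ≠ ∞) (g : S → ℝ≥0∞) :
    AEMeasurable (abstractHardy lam B g) mu := by
  set G : ℝ≥0∞ → ℝ≥0∞ := fun r =>
    ⨆ (z : Y) (_ : lam (B z) ≠ ∞) (_ : lam (B z) ≤ r), abstractHardy lam B g z
  have hG : Monotone G := fun r r' h =>
    iSup₂_mono fun z _ => iSup_mono' fun hz => ⟨hz.trans h, le_rfl⟩
  refine (hG.measurable.comp_aemeasurable hφ).congr ?_
  filter_upwards [hfin] with y hy
  refine le_antisymm (iSup₂_le fun z hz => iSup_le fun hzy => ?_) ?_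
  · exact abstractHardy_mono_of_le hmeas hchain g hz hzy
  · exact le_iSup₂_of_le y hy (le_iSup_of_le le_rfl le_rfl)

theorem aestronglyMeasurable_abstractHardyComplex (hmeas : ∀ y, MeasurableSet (B y))
    (hchain : IsChain (· ⊆ ·) (range B)) (hφ : AEMeasurable (fun y => lam (B y)) mu)
    (hfin : ∀ᵐ y ∂mu, lam (B y) ≠ ∞) {f : S → ℂ}
    (hf : ∀ᵐ y ∂mu, IntegrableOn f (B y) lam) :
    AEStronglyMeasurable (abstractHardyComplex lam B f) mu := by
  have hK : ∀ h : S → ℝ≥0∞, AEMeasurable (fun y => (abstractHardy lam B h y).toReal) mu :=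
    fun h => (aemeasurable_abstractHardy hmeas hchain hφ hfin h).ennreal_toReal
  have hre := (hK fun s => ENNReal.ofReal (f s).re).sub (hK fun s => ENNReal.ofReal (-(f s).re))
  have him := (hK fun s => ENNReal.ofReal (f s).im).sub (hK fun s => ENNReal.ofReal (-(f s).im))
  refine AEMeasurable.aestronglyMeasurable ?_
  refine ((Complex.measurable_ofReal.comp_aemeasurable hre).add
    ((Complex.measurable_ofReal.comp_aemeasurable him).mul_const Complex.I)).congr ?_
  filter_upwards [hf] with y hy
  rw [abstractHardyComplex, ← integral_re_add_im hy,
    integral_eq_lintegral_pos_part_sub_lintegral_neg_part hy.re,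
    integral_eq_lintegral_pos_part_sub_lintegral_neg_part hy.im]
  rfl

theorem integrableOn_of_memLp {p : ℝ≥0∞} (hp : 1 ≤ p) {f : S → ℂ} (hf : MemLp f p lam) {E : Set S}
    (hE : lam E ≠ ∞) : IntegrableOn f E lam := by
  have : IsFiniteMeasure (lam.restrict E) := ⟨by rw [Measure.restrict_apply_univ]; exact hE.lt_top⟩
  exact (hf.restrict E).integrable hp

omit [MeasurableSpace Y] in
theorem enorm_abstractHardyComplex_le (f : S → ℂ) (y : Y) :
    ‖abstractHardyComplex lam B f y‖ₑ ≤ abstractHardy lam B (fun s => ‖f s‖ₑ) y :=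
  enorm_integral_le_lintegral_enorm _

/-- A bounded Hardy operator acts on complex-valued functions. -/
theorem exists_continuousLinearMap_of_isBoundedOp (hmeas : ∀ y, MeasurableSet (B y))
    (hchain : IsChain (· ⊆ ·) (range B)) (hφ : AEMeasurable (fun y => lam (B y)) mu)
    (hfin : ∀ᵐ y ∂mu, lam (B y) ≠ ∞) {p q : ℝ≥0∞} [Fact (1 ≤ p)] [Fact (1 ≤ q)]
    (hb : IsBoundedOp lam mu (abstractHardy lam B) p q) :
    ∃ L : Lp ℂ p lam →L[ℂ] Lp ℂ q mu,
      ∀ f : Lp ℂ p lam, (L f : Y → ℂ) =ᵐ[mu] abstractHardyComplex lam B f := by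
  obtain ⟨C, hC, hCi⟩ := hb
  have hint : ∀ f : Lp ℂ p lam, ∀ᵐ y ∂mu, IntegrableOn f (B y) lam := fun f => by
    filter_upwards [hfin] with y hy
    exact integrableOn_of_memLp Fact.out (Lp.memLp f) hy
  have hle : ∀ f : Lp ℂ p lam,
      eLpNorm (abstractHardyComplex lam B f) q mu ≤ C * eLpNorm f p lam := fun f => by
    calc eLpNorm (abstractHardyComplex lam B f) q mu
        ≤ eLpNorm (abstractHardy lam B fun s => ‖f s‖ₑ) q mu :=
          eLpNorm_mono_enorm fun y => enorm_abstractHardyComplex_le _ y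
      _ ≤ C * eLpNorm (fun s => ‖f s‖ₑ) p lam := hCi _ (Lp.stronglyMeasurable f).enorm
      _ = C * eLpNorm f p lam := by rw [eLpNorm_enorm]
  have hmem : ∀ f : Lp ℂ p lam, MemLp (abstractHardyComplex lam B f) q mu := fun f =>
    ⟨aestronglyMeasurable_abstractHardyComplex hmeas hchain hφ hfin (hint f),
      (hle f).trans_lt (ENNReal.mul_lt_top hC.lt_top (Lp.eLpNorm_lt_top f))⟩
  let L : Lp ℂ p lam →ₗ[ℂ] Lp ℂ q mu :=
    { toFun := fun f => (hmem f).toLp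
      map_add' := fun f g => by
        rw [← MemLp.toLp_add]
        refine MemLp.toLp_congr _ _ ?_
        filter_upwards [hint f, hint g] with y hf hg
        rw [Pi.add_apply, abstractHardyComplex, abstractHardyComplex, abstractHardyComplex,
          ← integral_add hf hg]
        exact integral_congr_ae (ae_restrict_of_ae (Lp.coeFn_add f g))
      map_smul' := fun c f => by
        rw [RingHom.id_apply, ← MemLp.toLp_const_smul]
        refine MemLp.toLp_congr _ _ (ae_of_all _ fun y => ?_)
        rw [Pi.smul_apply, abstractHardyComplex, abstractHardyComplex, ← integral_smul]
        exact integral_congr_ae (ae_restrict_of_ae (Lp.coeFn_smul c f)) }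
  refine ⟨L.mkContinuous C.toReal fun f => ?_, fun f => (hmem f).coeFn_toLp⟩
  change ‖(hmem f).toLp‖ ≤ _
  rw [Lp.norm_toLp, Lp.norm_def, ← ENNReal.toReal_mul]
  exact ENNReal.toReal_mono (ENNReal.mul_ne_top hC (Lp.eLpNorm_ne_top f)) (hle f)

omit [MeasurableSpace Y] in
/-- Hölder continuity of the Hardy operator along the core. -/
theorem enorm_abstractHardyComplex_sub_le (hmeas : ∀ y, MeasurableSet (B y))
    (hchain : IsChain (· ⊆ ·) (range B)) {p : ℝ≥0∞} (hp : 1 ≤ p) {f : S → ℂ} (hf : MemLp f p lam)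
    {y z : Y} (hy : lam (B y) ≠ ∞) (hz : lam (B z) ≠ ∞) :
    ‖abstractHardyComplex lam B f y - abstractHardyComplex lam B f z‖ₑ ≤
      ENNReal.ofReal (dist (lam (B y)).toReal (lam (B z)).toReal) ^ (1 - 1 / p.toReal) *
        eLpNorm f p lam := by
  wlog hzy : B z ⊆ B y generalizing y z
  · rw [← enorm_neg, neg_sub, dist_comm]
    exact this hz hy ((hchain.total (mem_range_self z) (mem_range_self y)).resolve_left hzy)
  have hdiff : lam (B y \ B z) = ENNReal.ofReal (dist (lam (B y)).toReal (lam (B z)).toReal) := by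
    rw [measure_sdiff hzy (hmeas z).nullMeasurableSet hz, Real.dist_eq, abs_of_nonneg
      (sub_nonneg.2 (ENNReal.toReal_mono hy (measure_mono hzy))), ENNReal.ofReal_sub _
      ENNReal.toReal_nonneg, ENNReal.ofReal_toReal hy, ENNReal.ofReal_toReal hz]
  rw [abstractHardyComplex, abstractHardyComplex,
    ← setIntegral_sdiff (hmeas z) (integrableOn_of_memLp hp hf hy) hzy, ← hdiff]
  refine (enorm_integral_le_lintegral_enorm _).trans ?_
  refine (setLIntegral_le_rpow_mul_eLpNorm hp hf.1.enorm _).trans_eq ?_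
  rw [eLpNorm_enorm]

end Hardy

/-! ### Tails and their distribution -/

/-- Neighbourhoods of the ends of `(0,∞]`. -/
def tailSet (n : ℕ) : Set ℝ≥0∞ := {c | 0 < c ∧ (c ≤ (n + 1 : ℝ≥0∞)⁻¹ ∨ (n + 1 : ℝ≥0∞) < c)}

theorem measurableSet_tailSet (n : ℕ) : MeasurableSet (tailSet n) :=
  measurableSet_Ioi.inter (measurableSet_Iic.union measurableSet_Ioi)

theorem tailSet_antitone : Antitone tailSet := by
  intro m n hmn c hc
  have : (m + 1 : ℝ≥0∞) ≤ n + 1 := by gcongr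
  exact ⟨hc.1, hc.2.imp (fun h => h.trans (ENNReal.inv_le_inv.2 this)) this.trans_lt⟩

/-- Only ∞ can lie in every tail, so tails shrink to a null set once λ(B) is finite almost
everywhere. The value 0 is left out of the tails because the operator vanishes there. -/
theorem iInter_tailSet_subset : ⋂ n, tailSet n ⊆ {∞} := by
  intro c hc
  by_contra hne
  have h0 := (mem_iInter.1 hc 0).1
  obtain ⟨k, hk⟩ := ENNReal.exists_nat_gt (max_lt (ENNReal.inv_lt_top.2 h0)
    (lt_top_iff_ne_top.2 hne)).ne
  have hk' : max c⁻¹ c < (k + 1 : ℝ≥0∞) := hk.trans_le le_self_add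
  rcases (mem_iInter.1 hc k).2 with h | h
  · exact (((le_max_left _ _).trans_lt hk').trans_le (ENNReal.le_inv_iff_le_inv.1 h)).false
  · exact (((le_max_right _ _).trans_lt hk').trans h).false

/-- The distribution on a tail is written through the full distribution function, so
equimeasurability survives the restriction. Finite level sets make the subtraction legitimate. -/
theorem restrict_tailSet_apply {X : Type*} [MeasurableSpace X] {m : Measure X} {u : X → ℝ≥0∞}
    (hu : Measurable u) (hfin : ∀ s, s ≠ 0 → m {x | s < u x} ≠ ∞) (n : ℕ) (s : ℝ≥0∞) :
    m.restrict (u ⁻¹' tailSet n) {x | s < u x} =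
      m {x | max s (n + 1) < u x} + (m {x | s < u x} - m {x | max s (n + 1 : ℝ≥0∞)⁻¹ < u x}) := by
  set a : ℝ≥0∞ := (n + 1 : ℝ≥0∞)⁻¹
  set N : ℝ≥0∞ := n + 1
  have ha : a ≠ 0 := ENNReal.inv_ne_zero.2 (by finiteness)
  have haN : a ≤ N := (ENNReal.inv_le_one.2 le_add_self).trans le_add_self
  have hms : ∀ r : ℝ≥0∞, MeasurableSet {x | r < u x} := fun r =>
    measurableSet_lt measurable_const hu
  have hsets : {x | s < u x} ∩ u ⁻¹' tailSet n =
      {x | max s N < u x} ∪ ({x | s < u x} \ {x | max s a < u x}) := by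
    ext x
    simp only [tailSet, mem_inter_iff, mem_ofPred_eq, mem_preimage, mem_union, Set.mem_sdiff,
      max_lt_iff, not_and, not_lt]
    constructor
    · rintro ⟨hs, -, hx | hx⟩
      · exact Or.inr ⟨hs, fun _ => hx⟩
      · exact Or.inl ⟨hs, hx⟩
    · rintro (⟨hs, hx⟩ | ⟨hs, hx⟩)
      · exact ⟨hs, pos_of_gt hs, Or.inr hx⟩
      · exact ⟨hs, pos_of_gt hs, Or.inl (hx hs)⟩
  have hdisj : Disjoint {x | max s N < u x} ({x | s < u x} \ {x | max s a < u x}) :=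
    disjoint_sdiff_right.mono_left fun x hx => lt_of_le_of_lt (max_le_max le_rfl haN) hx
  have hsub : {x | max s a < u x} ⊆ {x | s < u x} := fun x hx =>
    (le_max_left s a).trans_lt hx
  have hpos : max s a ≠ 0 := (lt_of_lt_of_le (pos_iff_ne_zero.2 ha) (le_max_right _ _)).ne'
  rw [Measure.restrict_apply (hms s), hsets, measure_union hdisj ((hms s).diff (hms _)),
    measure_sdiff hsub (hms _).nullMeasurableSet (hfin _ hpos)]

/-- Restriction to corresponding tails preserves equimeasurability. -/
theorem Equimeasurable.restrict_tailSet {X₁ X₂ : Type*} [MeasurableSpace X₁] [MeasurableSpace X₂]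
    {m₁ : Measure X₁} {m₂ : Measure X₂} {u₁ : X₁ → ℝ≥0∞} {u₂ : X₂ → ℝ≥0∞}
    (h : Equimeasurable m₁ m₂ u₁ u₂) (h₁ : Measurable u₁) (h₂ : Measurable u₂)
    (hfin : ∀ s, s ≠ 0 → m₁ {x | s < u₁ x} ≠ ∞) (n : ℕ) :
    Equimeasurable (m₁.restrict (u₁ ⁻¹' tailSet n)) (m₂.restrict (u₂ ⁻¹' tailSet n)) u₁ u₂ := by
  intro s
  rw [restrict_tailSet_apply h₁ hfin, restrict_tailSet_apply h₂ fun s hs => h s ▸ hfin s hs,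
    h, h, h]

theorem one_sub_one_div_toReal_nonneg {p : ℝ≥0∞} (hp : 1 ≤ p) : 0 ≤ 1 - 1 / p.toReal := by
  rw [sub_nonneg, one_div]
  rcases eq_or_ne p ∞ with rfl | hpt
  · simp
  · exact inv_le_one_of_one_le₀ (by simpa using ENNReal.toReal_mono hpt hp)

/-! ### The tail criterion for compactness -/

section Criterion

variable {S Y : Type*} [MeasurableSpace S] [MeasurableSpace Y] {lam : Measure S} {mu : Measure Y}
  {B : Y → Set S}

/-- Necessity in the criterion: uniform smallness of tails for L is read off on non-negative
functions. The function ψ is a measurable version of λ∘B, which makes the tails measurable. -/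
theorem exists_hardyInequality_tail_of_isCompactOp
    (hfin : ∀ᵐ y ∂mu, lam (B y) ≠ ∞) {ψ : Y → ℝ≥0∞} (hψm : Measurable ψ)
    (hψ : ∀ᵐ y ∂mu, lam (B y) = ψ y) {p q : ℝ≥0∞} [Fact (1 ≤ p)] [Fact (1 ≤ q)] (hq : q ≠ ∞)
    (h : IsCompactOp lam mu (abstractHardy lam B) (abstractHardyComplex lam B) p q) {ε : ℝ}
    (hε : 0 < ε) : ∃ n, HardyInequality lam (mu.restrict (ψ ⁻¹' tailSet n)) (abstractHardy lam B)
      p q (ENNReal.ofReal ε) := by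
  obtain ⟨-, L, hL, hLc⟩ := h
  have hp : (1 : ℝ≥0∞) ≤ p := Fact.out
  have hZ0 : mu (⋂ n, ψ ⁻¹' tailSet n) = 0 := by
    have hae : ∀ᵐ y ∂mu, ψ y ≠ ∞ := by
      filter_upwards [hfin, hψ] with y h1 h2 using h2 ▸ h1
    refine measure_mono_null ?_ hae
    rw [← preimage_iInter]
    exact fun y hy => not_not_intro (iInter_tailSet_subset hy)
  obtain ⟨n, hn⟩ := exists_norm_restrict_le_of_isCompactOperator hq hLc
    (fun i j hij => preimage_mono (tailSet_antitone hij))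
    (fun n => hψm (measurableSet_tailSet n)) hZ0 hε
  refine ⟨n, fun g hg => ?_⟩
  by_cases hgp : eLpNorm g p lam = ∞
  · rw [hgp, ENNReal.mul_top (ENNReal.ofReal_pos.2 hε).ne']
    exact le_top
  have hle : ∀ s, ‖((g s).toReal : ℂ)‖ₑ ≤ ‖g s‖ₑ := fun s => by
    rw [enorm_eq_self, ← ofReal_norm, Complex.norm_real, Real.norm_eq_abs,
      abs_of_nonneg ENNReal.toReal_nonneg]
    exact ENNReal.ofReal_toReal_le
  have hmem : MemLp (fun s => ((g s).toReal : ℂ)) p lam :=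
    ⟨(Complex.measurable_ofReal.comp hg.ennreal_toReal).aestronglyMeasurable,
      (eLpNorm_mono_enorm hle).trans_lt (lt_top_iff_ne_top.2 hgp)⟩
  have hK : ∀ᵐ y ∂mu, ‖abstractHardy lam B g y‖ₑ ≤ ‖L hmem.toLp y‖ₑ := by
    filter_upwards [hfin, hL hmem.toLp] with y hy hLy
    -- By Hölder the integral is finite, so g is finite almost everywhere on B(y) and `toReal` loses
    -- nothing there.
    have hint : ∫⁻ s in B y, g s ∂lam ≠ ∞ := by
      refine ne_top_of_le_ne_top (ENNReal.mul_ne_top (ENNReal.rpow_ne_top_of_nonneg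
        (one_sub_one_div_toReal_nonneg hp) hy) hgp)
        (setLIntegral_le_rpow_mul_eLpNorm hp hg.aemeasurable _)
    have hval : abstractHardyComplex lam B hmem.toLp y = ((∫⁻ s in B y, g s ∂lam).toReal : ℂ) := by
      rw [abstractHardyComplex, integral_congr_ae (ae_restrict_of_ae hmem.coeFn_toLp),
        integral_complex_ofReal, integral_toReal hg.aemeasurable (ae_lt_top hg hint)]
    rw [hLy, hval, enorm_eq_self, ← ofReal_norm, Complex.norm_real, Real.norm_eq_abs,
      abs_of_nonneg ENNReal.toReal_nonneg, ENNReal.ofReal_toReal hint]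
    rfl
  calc eLpNorm (abstractHardy lam B g) q (mu.restrict (ψ ⁻¹' tailSet n))
      ≤ eLpNorm (L hmem.toLp) q (mu.restrict (ψ ⁻¹' tailSet n)) :=
        eLpNorm_mono_enorm_ae (ae_restrict_of_ae hK)
    _ = ‖LpToLpRestrictCLM Y ℂ ℂ mu q (ψ ⁻¹' tailSet n) (L hmem.toLp)‖ₑ := by
        rw [Lp.enorm_def, eLpNorm_congr_ae (LpToLpRestrictCLM_coeFn ℂ _ _)]
    _ ≤ ENNReal.ofReal (ε * ‖hmem.toLp‖) := by
        rw [← ofReal_norm]; exact ENNReal.ofReal_le_ofReal (hn _)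
    _ = ENNReal.ofReal ε * eLpNorm (fun s => ((g s).toReal : ℂ)) p lam := by
        rw [ENNReal.ofReal_mul hε.le, ofReal_norm, Lp.enorm_toLp]
    _ ≤ ENNReal.ofReal ε * eLpNorm g p lam := by
        gcongr; exact eLpNorm_mono_enorm hle

/-- Evaluation of the integral over a set of finite measure is continuous on `L^p`. -/
theorem exists_continuousLinearMap_setIntegral {p : ℝ≥0∞} [Fact (1 ≤ p)] {E : Set S}
    (hE : lam E ≠ ∞) : ∃ T : Lp ℂ p lam →L[ℂ] ℂ, ∀ f : Lp ℂ p lam, T f = ∫ s in E, f s ∂lam := by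
  have hp : (1 : ℝ≥0∞) ≤ p := Fact.out
  have hint : ∀ f : Lp ℂ p lam, IntegrableOn f E lam := fun f =>
    integrableOn_of_memLp hp (Lp.memLp f) hE
  have hc : lam E ^ (1 - 1 / p.toReal) ≠ ∞ :=
    ENNReal.rpow_ne_top_of_nonneg (one_sub_one_div_toReal_nonneg hp) hE
  let T : Lp ℂ p lam →ₗ[ℂ] ℂ :=
    { toFun := fun f => ∫ s in E, f s ∂lam
      map_add' := fun f g => by
        rw [← integral_add (hint f) (hint g)]
        exact integral_congr_ae (ae_restrict_of_ae (Lp.coeFn_add f g))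
      map_smul' := fun c f => by
        rw [RingHom.id_apply, ← integral_smul]
        exact integral_congr_ae (ae_restrict_of_ae (Lp.coeFn_smul c f)) }
  refine ⟨T.mkContinuous (lam E ^ (1 - 1 / p.toReal)).toReal fun f => ?_, fun f => rfl⟩
  have h1 : ‖T f‖ₑ ≤ lam E ^ (1 - 1 / p.toReal) * ‖f‖ₑ := by
    refine (enorm_integral_le_lintegral_enorm _).trans
      ((setLIntegral_le_rpow_mul_eLpNorm hp (Lp.memLp f).1.enorm _).trans_eq ?_)
    rw [eLpNorm_enorm, Lp.enorm_def]
  rw [← toReal_enorm, ← toReal_enorm f, ← ENNReal.toReal_mul]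
  exact ENNReal.toReal_mono (ENNReal.mul_ne_top hc enorm_ne_top) h1

/-- Sufficiency: the tail contributes at most ε/2, and on the middle part, of finite measure, Hölder
continuity in λ(B(y)) reduces matters to integrals over finitely many core sets. -/
theorem isCompactOp_of_hardyInequality_tail (hmeas : ∀ y, MeasurableSet (B y))
    (hchain : IsChain (· ⊆ ·) (range B)) {ψ : Y → ℝ≥0∞} (hψm : Measurable ψ)
    (hψ : ∀ᵐ y ∂mu, lam (B y) = ψ y) (hfin : ∀ᵐ y ∂mu, lam (B y) ≠ ∞)
    (hlev : ∀ s, s ≠ 0 → mu {y | s < ψ y} ≠ ∞)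
    {p q : ℝ≥0∞} [Fact (1 ≤ p)] [Fact (1 ≤ q)] (hp : 1 < p) (hpt : p ≠ ∞) (hq : q ≠ ∞)
    (hb : IsBoundedOp lam mu (abstractHardy lam B) p q)
    (h : ∀ ε : ℝ, 0 < ε → ∃ n, HardyInequality lam (mu.restrict (ψ ⁻¹' tailSet n))
      (abstractHardy lam B) p q (ENNReal.ofReal ε)) :
    IsCompactOp lam mu (abstractHardy lam B) (abstractHardyComplex lam B) p q := by
  have hφ : AEMeasurable (fun y => lam (B y)) mu := ⟨ψ, hψm, hψ⟩
  have hq0 : q ≠ 0 := (one_pos.trans_le (Fact.out : 1 ≤ q)).ne'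
  obtain ⟨L, hL⟩ := exists_continuousLinearMap_of_isBoundedOp hmeas hchain hφ hfin hb
  refine ⟨hb, L, hL, isCompactOperator_of_forall_le L fun ε hε => ?_⟩
  obtain ⟨n, hn⟩ := h (ε / 2) (half_pos hε)
  set a : ℝ≥0∞ := (n + 1 : ℝ≥0∞)⁻¹ with ha
  set N : ℝ≥0∞ := n + 1 with hN
  have ha0 : a ≠ 0 := ENNReal.inv_ne_zero.2 (by finiteness)
  set Z : Set Y := ψ ⁻¹' tailSet n with hZ
  have hZm : MeasurableSet Z := hψm (measurableSet_tailSet n)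
  set D : Set Y := ψ ⁻¹' Ioc a N with hD
  have hDm : MeasurableSet D := hψm measurableSet_Ioc
  set M₀ : ℝ≥0∞ := mu D ^ (1 / q.toReal) with hM₀
  have hM₀fin : M₀ ≠ ∞ := ENNReal.rpow_ne_top_of_nonneg (by positivity)
    (measure_ne_top_of_subset (fun y hy => hy.1) (hlev a ha0))
  have hθ : 0 < 1 - 1 / p.toReal := by
    have : 1 < p.toReal := by simpa using ENNReal.toReal_strict_mono hpt hp
    rw [sub_pos, one_div]
    exact inv_lt_one_of_one_lt₀ this
  -- The mesh η makes the Hölder error on the middle part at most (ε/2)‖f‖; this is where p > 1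
  -- enters, through the positive exponent.
  obtain ⟨η, hη, hηM⟩ : ∃ η : ℝ, 0 < η ∧
      ENNReal.ofReal η ^ (1 - 1 / p.toReal) * M₀ ≤ ENNReal.ofReal (ε / 2) := by
    have hlim : Tendsto (fun η : ℝ => ENNReal.ofReal η ^ (1 - 1 / p.toReal) * M₀) (𝓝[>] 0)
        (𝓝 0) := by
      have h1 : Tendsto (fun η : ℝ => ENNReal.ofReal η) (𝓝[>] 0) (𝓝 0) := by
        simpa using (ENNReal.tendsto_ofReal tendsto_id).mono_left (nhdsWithin_le_nhds (a := (0:ℝ)))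
      have h2 := ENNReal.Tendsto.mul_const (h1.ennrpow_const (1 - 1 / p.toReal)) (b := M₀)
        (Or.inr hM₀fin)
      rwa [ENNReal.zero_rpow_of_pos hθ, zero_mul] at h2
    obtain ⟨η, h1, h2⟩ := ((hlim.eventually (gt_mem_nhds
      (ENNReal.ofReal_pos.2 (half_pos hε)))).and self_mem_nhdsWithin).exists
    exact ⟨η, h2, h1.le⟩
  set G : Set Y := {y | y ∈ D ∧ lam (B y) = ψ y} with hG
  have hGfin : ∀ y ∈ G, lam (B y) ≠ ∞ := fun y hy =>
    hy.2 ▸ ne_top_of_le_ne_top (by finiteness) hy.1.2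
  have hGtb : TotallyBounded ((fun y => (lam (B y)).toReal) '' G) := by
    refine (totallyBounded_Icc (0 : ℝ) N.toReal).subset ?_
    rintro _ ⟨y, hy, rfl⟩
    exact ⟨ENNReal.toReal_nonneg, ENNReal.toReal_mono (by finiteness) (hy.2 ▸ hy.1.2)⟩
  obtain ⟨t, ht, htf, hcov⟩ := Metric.finite_approx_of_totallyBounded hGtb η hη
  obtain ⟨t', ht', htf', rfl⟩ := exists_subset_image_finite_and.1 ⟨t, ht, htf, rfl⟩
  have hT : ∀ z : t', ∃ T : Lp ℂ p lam →L[ℂ] ℂ, ∀ f : Lp ℂ p lam, T f = ∫ s in B z, f s ∂lam :=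
    fun z => exists_continuousLinearMap_setIntegral (hGfin z (ht' z.2))
  choose T hT using hT
  have : Fintype t' := htf'.fintype
  let e := Fintype.equivFin t'
  refine ⟨Fintype.card t', ContinuousLinearMap.pi fun i => T (e.symm i), M₀.toReal,
    ENNReal.toReal_nonneg, fun f => ?_⟩
  set Tf := ContinuousLinearMap.pi (fun i => T (e.symm i)) f with hTf
  set c : ℝ≥0∞ := ENNReal.ofReal η ^ (1 - 1 / p.toReal) * ‖f‖ₑ + ‖Tf‖ₑ with hc
  -- Off the tail either ψ y = 0 and the output vanishes, or y lies in D and is compared with a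
  -- nearby net point.
  have hpoint : ∀ᵐ y ∂mu, y ∈ Zᶜ → ‖L f y‖ₑ ≤ ‖D.indicator (fun _ => c) y‖ₑ := by
    filter_upwards [hψ, hL f] with y hy hLy hyZ
    rw [hLy, enorm_eq_self]
    rcases eq_or_ne (ψ y) 0 with h0 | h0
    · rw [abstractHardyComplex, setIntegral_measure_zero _ (hy.trans h0), enorm_zero]
      exact zero_le
    have hyD : y ∈ D := by
      by_contra hyD
      refine hyZ ⟨pos_iff_ne_zero.2 h0, ?_⟩
      by_contra hcon
      push Not at hcon
      exact hyD hcon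
    rw [indicator_of_mem hyD]
    have hyG : y ∈ G := ⟨hyD, hy⟩
    obtain ⟨_, ⟨z, hz, rfl⟩, hyz⟩ := mem_iUnion₂.1 (hcov (mem_image_of_mem _ hyG))
    have h1 := enorm_abstractHardyComplex_sub_le hmeas hchain hp.le (Lp.memLp f) (hGfin y hyG)
      (hGfin z (ht' hz))
    have h2 : ‖abstractHardyComplex lam B f z‖ₑ ≤ ‖Tf‖ₑ := by
      have : abstractHardyComplex lam B f z = Tf (e ⟨z, hz⟩) := by
        rw [hTf, ContinuousLinearMap.pi_apply, e.symm_apply_apply, hT, abstractHardyComplex]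
      rw [this, ← ofReal_norm, ← ofReal_norm]
      exact ENNReal.ofReal_le_ofReal (norm_le_pi_norm Tf _)
    calc ‖abstractHardyComplex lam B f y‖ₑ
        = ‖(abstractHardyComplex lam B f y - abstractHardyComplex lam B f z) +
            abstractHardyComplex lam B f z‖ₑ := by rw [sub_add_cancel]
      _ ≤ _ := enorm_add_le _ _
      _ ≤ c := by
        refine add_le_add (h1.trans ?_) h2
        rw [Lp.enorm_def]
        gcongr
        exact (Metric.mem_ball.1 hyz).le
  have htail : eLpNorm (Z.indicator (L f)) q mu ≤ ENNReal.ofReal (ε / 2) * ‖f‖ₑ := by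
    rw [eLpNorm_indicator_eq_eLpNorm_restrict hZm, Lp.enorm_def, ← eLpNorm_enorm (f : S → ℂ)]
    refine le_trans (eLpNorm_mono_enorm_ae (ae_restrict_of_ae ?_)) (hn _
      (Lp.stronglyMeasurable f).enorm)
    filter_upwards [hL f] with y hy
    rw [hy, enorm_eq_self]
    exact enorm_abstractHardyComplex_le _ _
  have hmid : eLpNorm (Zᶜ.indicator (L f)) q mu ≤ c * M₀ := by
    calc eLpNorm (Zᶜ.indicator (L f)) q mu ≤ eLpNorm (D.indicator fun _ => c) q mu := by
          refine eLpNorm_mono_enorm_ae ?_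
          filter_upwards [hpoint] with y hy
          by_cases hyZ : y ∈ Zᶜ
          · rw [indicator_of_mem hyZ]; exact hy hyZ
          · rw [indicator_of_notMem hyZ, enorm_zero]; exact zero_le
      _ = c * M₀ := by rw [eLpNorm_indicator_const hDm hq0 hq, enorm_eq_self]
  have hLm : AEStronglyMeasurable (L f) mu := (Lp.memLp (L f)).1
  have htotal : ‖L f‖ₑ ≤ ENNReal.ofReal ε * ‖f‖ₑ + M₀ * ‖Tf‖ₑ := by
    calc ‖L f‖ₑ = eLpNorm (Z.indicator (L f) + Zᶜ.indicator (L f)) q mu := by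
          rw [indicator_self_add_compl, Lp.enorm_def]
      _ ≤ ENNReal.ofReal (ε / 2) * ‖f‖ₑ + c * M₀ :=
          (eLpNorm_add_le (hLm.indicator hZm) (hLm.indicator hZm.compl) Fact.out).trans
            (add_le_add htail hmid)
      _ = ENNReal.ofReal (ε / 2) * ‖f‖ₑ + ENNReal.ofReal η ^ (1 - 1 / p.toReal) * M₀ * ‖f‖ₑ +
            M₀ * ‖Tf‖ₑ := by rw [hc]; ring
      _ ≤ ENNReal.ofReal (ε / 2) * ‖f‖ₑ + ENNReal.ofReal (ε / 2) * ‖f‖ₑ + M₀ * ‖Tf‖ₑ := by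
          gcongr
      _ = ENNReal.ofReal ε * ‖f‖ₑ + M₀ * ‖Tf‖ₑ := by
          rw [← add_mul, ← ENNReal.ofReal_add (half_pos hε).le (half_pos hε).le, add_halves]
  rw [← toReal_enorm, ← toReal_enorm f, ← toReal_enorm Tf, ← ENNReal.toReal_mul,
    ← ENNReal.toReal_ofReal hε.le, ← ENNReal.toReal_mul, ← ENNReal.toReal_add]
  · exact ENNReal.toReal_mono (by finiteness) htotal
  · finiteness
  · finiteness

end Criterion

/-! ### Transfer of compactness to the normal form -/

theorem Equimeasurable.congr_left {X₁ X₂ : Type*} [MeasurableSpace X₁] [MeasurableSpace X₂]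
    {m₁ : Measure X₁} {m₂ : Measure X₂} {u₁ v₁ : X₁ → ℝ≥0∞} {u₂ : X₂ → ℝ≥0∞}
    (h : Equimeasurable m₁ m₂ u₁ u₂) (huv : u₁ =ᵐ[m₁] v₁) : Equimeasurable m₁ m₂ v₁ u₂ := by
  intro s
  rw [← h s]
  refine measure_congr ?_
  filter_upwards [huv] with x hx
  exact congrArg (s < ·) hx.symm

/-- No strict superlevel set equals {u = ∞}, so its measure is recovered from the distribution
function by continuity from above, which needs finite level sets. -/
theorem measure_eq_top_eq_iInf {X : Type*} [MeasurableSpace X] {m : Measure X} {u : X → ℝ≥0∞}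
    (hu : Measurable u) (hfin : ∀ s, s ≠ 0 → m {x | s < u x} ≠ ∞) :
    m {x | u x = ∞} = ⨅ n : ℕ, m {x | (n + 1 : ℝ≥0∞) < u x} := by
  have hset : {x | u x = ∞} = ⋂ n : ℕ, {x | (n + 1 : ℝ≥0∞) < u x} := by
    ext x
    simp only [mem_ofPred_eq, mem_iInter]
    refine ⟨fun h n => h ▸ by finiteness, fun h => ?_⟩
    by_contra hne
    obtain ⟨n, hn⟩ := ENNReal.exists_nat_gt hne
    exact ((hn.trans_le le_self_add).trans (h n)).false
  have hanti : Antitone fun n : ℕ => {x | (n + 1 : ℝ≥0∞) < u x} := fun i j hij x hx =>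
    lt_of_le_of_lt (show (i + 1 : ℝ≥0∞) ≤ j + 1 by gcongr) hx
  rw [hset]
  exact hanti.measure_iInter
    (fun n => (measurableSet_lt measurable_const hu).nullMeasurableSet) ⟨0, hfin _ (by simp)⟩

theorem Equimeasurable.measure_eq_top {X₁ X₂ : Type*} [MeasurableSpace X₁] [MeasurableSpace X₂]
    {m₁ : Measure X₁} {m₂ : Measure X₂} {u₁ : X₁ → ℝ≥0∞} {u₂ : X₂ → ℝ≥0∞}
    (h : Equimeasurable m₁ m₂ u₁ u₂) (h₁ : Measurable u₁) (h₂ : Measurable u₂)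
    (hfin : ∀ s, s ≠ 0 → m₁ {x | s < u₁ x} ≠ ∞) : m₁ {x | u₁ x = ∞} = m₂ {x | u₂ x = ∞} := by
  rw [measure_eq_top_eq_iInf h₁ hfin, measure_eq_top_eq_iInf h₂ fun s hs => h s ▸ hfin s hs]
  exact iInf_congr fun n => h _

/-- Testing a Hardy inequality on indicator functions of intervals. -/
theorem measure_lt_ne_top_of_hardyInequality {X : Type*} [MeasurableSpace X] {m : Measure X}
    {b : X → ℝ≥0∞} (hb : AEMeasurable b m) {p q C : ℝ≥0∞} (hp0 : p ≠ 0) (hpt : p ≠ ∞)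
    (hq0 : q ≠ 0) (hqt : q ≠ ∞) (hC : C ≠ ∞)
    (h : HardyInequality halfLine m (fun f x => primitive f (b x)) p q C) {s : ℝ≥0∞}
    (hs : s ≠ 0) : m {x | s < b x} ≠ ∞ := by
  rcases eq_or_ne s ∞ with rfl | hst
  · simp
  set f : ℝ → ℝ≥0∞ := (initialInterval s).indicator fun _ => 1 with hf
  have hI := measurableSet_initialInterval s
  have hfnorm : eLpNorm f p halfLine ≠ ∞ := by
    rw [hf, eLpNorm_indicator_const hI hp0 hpt, halfLine, Measure.restrict_apply hI,
      inter_eq_left.2 (initialInterval_subset_Ioi s), volume_initialInterval]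
    exact ENNReal.mul_ne_top (by simp) (ENNReal.rpow_ne_top_of_nonneg (by positivity) hst)
  -- Thus {b > s} lies where the output is at least s, and Chebyshev bounds its measure.
  have hprim : ∀ c, primitive f c = min s c := fun c => by
    rw [primitive, hf, lintegral_indicator_const hI, one_mul, Measure.restrict_apply hI,
      initialInterval_inter, volume_initialInterval]
  have hnorm : eLpNorm (fun x => primitive f (b x)) q m ≠ ∞ :=
    ne_top_of_le_ne_top (ENNReal.mul_ne_top hC hfnorm) (h f (measurable_const.indicator hI))
  have hmark := meas_ge_le_mul_pow_eLpNorm_enorm m hq0 hqt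
    ((measurable_primitive f).comp_aemeasurable hb).aestronglyMeasurable hs
    (fun hst' => absurd hst' hst)
  refine ne_top_of_le_ne_top ?_ ((measure_mono fun x hx => ?_).trans hmark)
  · exact ENNReal.mul_ne_top (ENNReal.rpow_ne_top_of_nonneg (by positivity) (by simpa using hs))
      (ENNReal.rpow_ne_top_of_nonneg (by positivity) hnorm)
  · change s ≤ ‖primitive f (b x)‖ₑ
    rw [enorm_eq_self, hprim]
    exact le_min le_rfl (le_of_lt hx)

theorem isChain_range_initialInterval {X : Type*} (b : X → ℝ≥0∞) :
    IsChain (· ⊆ ·) (range fun x => initialInterval (b x)) := by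
  rintro _ ⟨x, rfl⟩ _ ⟨y, rfl⟩ -
  exact (le_total (b x) (b y)).imp initialInterval_mono initialInterval_mono

theorem halfLine_restrict_initialInterval (c : ℝ≥0∞) :
    halfLine.restrict (initialInterval c) = volume.restrict (initialInterval c) := by
  rw [halfLine, Measure.restrict_restrict (measurableSet_initialInterval c),
    inter_eq_left.2 (initialInterval_subset_Ioi c)]

theorem halfLine_initialInterval (c : ℝ≥0∞) : halfLine (initialInterval c) = c := by
  rw [← Measure.restrict_apply_univ, halfLine_restrict_initialInterval,
    Measure.restrict_apply_univ, volume_initialInterval]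

theorem abstractHardy_initialInterval (b : ℝ → ℝ≥0∞) :
    abstractHardy halfLine (fun x => initialInterval (b x)) = normalHardy b := by
  ext f x
  rw [abstractHardy, halfLine_restrict_initialInterval, normalHardy]

theorem abstractHardyComplex_initialInterval (b : ℝ → ℝ≥0∞) :
    abstractHardyComplex halfLine (fun x => initialInterval (b x)) = normalHardyComplex b := by
  ext f x
  rw [abstractHardyComplex, halfLine_restrict_initialInterval, normalHardyComplex]

/-- Compactness of Hardy operators in terms of the normal form. -/
theorem isCompactOp_iff_of_equimeasurable {S Y : Type*} [MeasurableSpace S] [MeasurableSpace Y]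
    {lam : Measure S} {mu : Measure Y} [SFinite lam] [SFinite mu] {B : Y → Set S}
    (hmeas : ∀ y, MeasurableSet (B y)) (hchain : IsChain (· ⊆ ·) (range B))
    (hφ : AEMeasurable (fun y => lam (B y)) mu) (hfin : ∀ y, lam (B y) ≠ ∞) {b : ℝ → ℝ≥0∞}
    (hb : Measurable b) (heq : Equimeasurable mu halfLine (fun y => lam (B y)) b)
    {p q : ℝ≥0∞} [Fact (1 ≤ p)] [Fact (1 ≤ q)] (hp : 1 < p) (hpt : p ≠ ∞) (hqt : q ≠ ∞) :
    IsCompactOp lam mu (abstractHardy lam B) (abstractHardyComplex lam B) p q ↔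
      IsCompactOp halfLine halfLine (normalHardy b) (normalHardyComplex b) p q := by
  have hq0 : q ≠ 0 := (one_pos.trans_le (Fact.out : 1 ≤ q)).ne'
  have hHardy : ∀ C, HardyInequality lam mu (abstractHardy lam B) p q C ↔
      HardyInequality halfLine halfLine (normalHardy b) p q C := fun C =>
    hardyInequality_iff_of_equimeasurable hmeas hchain hφ hfin hb.aemeasurable heq hp.le
  have hbdd : IsBoundedOp lam mu (abstractHardy lam B) p q ↔
      IsBoundedOp halfLine halfLine (normalHardy b) p q :=
    exists_congr fun C => and_congr_right fun _ => hHardy C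
  by_cases hbd : IsBoundedOp halfLine halfLine (normalHardy b) p q
  swap
  · exact ⟨fun h => absurd (hbdd.1 h.1) hbd, fun h => absurd h.1 hbd⟩
  obtain ⟨C, hC, hCi⟩ := id hbd
  have hlev : ∀ s, s ≠ 0 → halfLine {x | s < b x} ≠ ∞ := fun s hs =>
    measure_lt_ne_top_of_hardyInequality hb.aemeasurable (one_pos.trans hp).ne' hpt hq0 hqt hC
      hCi hs
  obtain ⟨ψ, hψm, hψ⟩ := id hφ
  have heq' : Equimeasurable mu halfLine ψ b := heq.congr_left hψ
  have hlev' : ∀ s, s ≠ 0 → mu {y | s < ψ y} ≠ ∞ := fun s hs => heq' s ▸ hlev s hs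
  have htail : ∀ (n : ℕ) (C : ℝ≥0∞),
      HardyInequality lam (mu.restrict (ψ ⁻¹' tailSet n)) (abstractHardy lam B) p q C ↔
      HardyInequality halfLine (halfLine.restrict (b ⁻¹' tailSet n)) (normalHardy b) p q C :=
    fun n C => hardyInequality_iff_of_equimeasurable hmeas hchain hφ.restrict hfin
      hb.aemeasurable ((heq'.restrict_tailSet hψm hb hlev' n).congr_left
        (Filter.EventuallyEq.symm (ae_restrict_of_ae hψ))) hp.le
  -- Finiteness of the core measures passes to b almost everywhere, as the criterion requires.
  have hbfin : ∀ᵐ x ∂halfLine, b x ≠ ∞ := by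
    have h0 : mu {y | ψ y = ∞} = 0 := by
      have : ∀ᵐ y ∂mu, ψ y ≠ ∞ := hψ.mono fun y hy => hy ▸ hfin y
      simpa [ae_iff] using this
    rw [ae_iff]
    simpa using (heq'.measure_eq_top hψm hb hlev').symm.trans h0
  have hbae : ∀ᵐ x ∂halfLine, halfLine (initialInterval (b x)) = b x :=
    ae_of_all _ fun x => halfLine_initialInterval _
  have hbfin' : ∀ᵐ x ∂halfLine, halfLine (initialInterval (b x)) ≠ ∞ := by
    simpa only [halfLine_initialInterval] using hbfin
  -- H_b is itself an abstract Hardy operator, with core x ↦ (0, b x), so one criterion serves both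
  -- sides.
  rw [← abstractHardy_initialInterval, ← abstractHardyComplex_initialInterval] at *
  constructor
  · intro h
    refine isCompactOp_of_hardyInequality_tail (fun x => measurableSet_initialInterval _)
      (isChain_range_initialInterval b) hb hbae hbfin' hlev hp hpt hqt hbd fun ε hε => ?_
    obtain ⟨n, hn⟩ := exists_hardyInequality_tail_of_isCompactOp (ae_of_all _ hfin) hψm hψ hqt h hε
    exact ⟨n, (htail n _).1 hn⟩
  · intro h
    refine isCompactOp_of_hardyInequality_tail hmeas hchain hψm hψ (ae_of_all _ hfin) hlev' hp hpt
      hqt (hbdd.2 hbd) fun ε hε => ?_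
    obtain ⟨n, hn⟩ := exists_hardyInequality_tail_of_isCompactOp hbfin' hb hbae hqt h hε
    exact ⟨n, (htail n _).2 hn⟩

end HardyNF

/-! ### The main theorem -/

open HardyNF
theorem theorem2p1 {S Y : Type*} [MeasurableSpace S] [MeasurableSpace Y]
    (lam : Measure S) (mu : Measure Y) [SigmaFinite lam] [SigmaFinite mu]
    (B : Y → Set S) (hB : IsCoreMap lam mu B)
    (b : ℝ → ℝ≥0∞) (hb : b = rearrangement mu (fun y => lam (B y))) :
    IsNormalFormParameter b ∧
    (∀ p q : ℝ≥0∞, 1 ≤ p → 0 < q →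
      (IsBoundedOp lam mu (abstractHardy lam B) p q ↔
        IsBoundedOp halfLine halfLine (normalHardy b) p q) ∧
      opNorm lam mu (abstractHardy lam B) p q = normalFormNorm p q b) ∧
    (∀ (p q : ℝ≥0∞) [Fact (1 ≤ p)] [Fact (1 ≤ q)], 1 < p → p ≤ q → q < ∞ →
      (IsCompactOp lam mu (abstractHardy lam B) (abstractHardyComplex lam B) p q ↔
        IsCompactOp halfLine halfLine (normalHardy b) (normalHardyComplex b) p q)) := by
  have hφ : AEMeasurable (fun y => lam (B y)) mu := by
    simpa using hB.measurability univ MeasurableSet.univ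
  have hfin : ∀ y, lam (B y) ≠ ∞ := fun y => (hB.finiteness y).ne
  have hbm : Measurable b := hb ▸ measurable_rearrangement _ _
  have heq : Equimeasurable mu halfLine (fun y => lam (B y)) b :=
    hb ▸ equimeasurable_rearrangement _ _
  refine ⟨hb ▸ (rearrangement_antitone _ _).antitoneOn _, fun p q hp _ => ?_,
    fun p q _ _ hp hpq hq => ?_⟩
  · have hHardy : ∀ C, HardyInequality lam mu (abstractHardy lam B) p q C ↔
        HardyInequality halfLine halfLine (normalHardy b) p q C := fun C =>
      hardyInequality_iff_of_equimeasurable hB.measurableSet hB.totallyOrdered hφ hfin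
        hbm.aemeasurable heq hp
    refine ⟨exists_congr fun C => and_congr_right fun _ => hHardy C, ?_⟩
    simp only [opNorm, normalFormNorm, hHardy]
  · exact isCompactOp_iff_of_equimeasurable hB.measurableSet hB.totallyOrdered hφ hfin hbm heq hp
      (hpq.trans_lt hq).ne hq.ne
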